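/- **Setting.** Let $X$ and $Z$ be independent, square integrable, zero-mean random vectors with values in $\mathbb{R}^N$ and $\mathbb{R}^M$ and with invertible covariance matrices $C_{XX}$, $C_{ZZ}$. Let $A\in\mathbb{R}^{M\times N}$, let $Y=AX+Z$, and let $C_{YY}$ be the covariance matrix of $Y$. The linear minimum mean squared error (LMMSE) estimator is $$f_{\mathrm{LMMSE}}(Y)=(A^\top C_{ZZ}^{-1}A+C_{XX}^{-1})^{-1}A^\top C_{ZZ}^{-1}Y ;$$ its estimation error is $E=X-f_{\mathrm{LMMSE}}(Y)$, and its mean squared error is the trace of $$C_{EE}=C_{XX}-C_{XX}A^\top(AC_{XX}A^\top+C_{ZZ})^{-1}AC_{XX}.$$ The minimum mean squared error (MMSE) estimator is $\mathbb{E}[X\mid Y]$. Given $n$ independent samples $(X_i,Y_i)_{i=1}^n$ of $(X,Y)$, the least squares estimator $\hat f$ is the unique minimizer (if it exists) of $\frac1n\sum_{i=1}^n\|f(Y_i)-X_i\|_2^2$ over all linear maps $f\colon\mathbb{R}^M\to\mathbb{R}^N$. A random vector $V$ is called *$\sigma$-sub-Gaussian* ($\sigma\ge 0$) if $\mathbb{E}\,e^{\lambda(a^\top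 V-\mathbb{E}[a^\top V])}\le e^{\sigma^2\lambda^2/2}$ for all $\lambda\in\mathbb{R}$ and all $a$ with $\|a\|_2=1$. The spectral norm of a matrix $C$ is denoted by $\|C\|_2$. **The constant $c$.** Call $c>0$ *admissible* if for all $n$, $M$ and $\rho$, every $n\times M$ random matrix $\boldsymbol{Z}$ whose rows are independent zero-mean $\rho$-sub-Gaussian random vectors with identity covariance matrix, and every $t\ge0$, one has, with probability at least $1-2e^{-t}$, $$\sqrt n-c\rho^2(\sqrt M+\sqrt t)\le\sigma_{\min}(\boldsymbol{Z})\le\sigma_{\max}(\boldsymbol{Z})\le\sqrt n+c\rho^2(\sqrt M+\sqrt t),$$ where $\sigma_{\min}(\boldsymbol{Z})$ and $\sigma_{\max}(\boldsymbol{Z})$ are the minimum and the maximum of $\|\boldsymbol{Z}v\|_2$ over unit vectors $v\in\mathbb{R}^M$. **Proposition.** An admissible absolute constant exists. Let $c>0$ be any admissible constant and assume that 1. there is a symmetric positive definite $C\in\mathbb{R}^{N\times N}$ such that, almost surely, $\mathbb{E}\big[\exp(\alpha^\top C^{-1/2}(E-\mathbb{E}[E\mid Y]))\mid Y\big]\le\exp(\|\alpha\|_2^2/2)$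 for all $\alpha\in\mathbb{R}^N$; 2. $C_{YY}^{-1/2}Y$ is a $\rho$-sub-Gaussian random vector; 3. the LMMSE and the MMSE estimators coincide: $\mathbb{E}[X\mid Y]=f_{\mathrm{LMMSE}}(Y)$, i.e. $\mathbb{E}[E\mid Y]=0$, almost surely. Let $\varepsilon>0$, $\delta\in(0,1)$, and let $n\in\mathbb{N}$ satisfy $$n\ \ge\ \left(\sqrt{\frac{M\operatorname{tr}C+2\sqrt{M\operatorname{tr}(C^2)\ln(3/\delta)}+2\|C\|_2\ln(3/\delta)}{\varepsilon\operatorname{tr}C_{EE}}}+c\rho^2\Big(\sqrt M+\sqrt{\ln(3/\delta)}\Big)\right)^2 .$$ Then, with probability at least $1-\delta$ over the $n$ samples, the least squares estimator $\hat f$ exists uniquely and its mean squared error satisfies $$\mathbb{E}_{X,Y}\|\hat f(Y)-X\|_2^2\le(1+\varepsilon)\operatorname{tr}C_{EE}.$$ -/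

import Mathlib

open MeasureTheory ProbabilityTheory
open scoped NNReal

noncomputable section

/-- The vector `A v`, for a real matrix `A` and a vector `v` of a Euclidean space. -/
def mulEuc {m n : ℕ} (A : Matrix (Fin m) (Fin n) ℝ) (v : EuclideanSpace ℝ (Fin n)) :
    EuclideanSpace ℝ (Fin m) :=
  Matrix.toEuclideanLin A v

/-- The covariance matrix of a random vector `V`. -/
def covMat {Ω : Type*} [MeasurableSpace Ω] {n : ℕ} (P : Measure Ω)
    (V : Ω → EuclideanSpace ℝ (Fin n)) : Matrix (Fin n) (Fin n) ℝ :=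
  Matrix.of fun i j => covariance (fun ω => V ω i) (fun ω => V ω j) P

open scoped MatrixOrder in
/-- `C ^ (-1/2)`, the inverse of the positive semidefinite square root, for a positive definite
matrix `C`. -/
def invSqrt {n : ℕ} (C : Matrix (Fin n) (Fin n) ℝ) : Matrix (Fin n) (Fin n) ℝ :=
  (CFC.sqrt C)⁻¹

/-- The spectral norm of a square matrix: its operator norm for the Euclidean norm. -/
def specNorm {n : ℕ} (C : Matrix (Fin n) (Fin n) ℝ) : ℝ :=
  ‖Matrix.toEuclideanCLM (n := Fin n) (𝕜 := ℝ) C‖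

/-- `V` is a `σ`-sub-Gaussian random vector: for every unit vector `a`, the random variable
`⟨a, V⟩` satisfies `𝔼 exp (t (⟨a, V⟩ - 𝔼 ⟨a, V⟩)) ≤ exp (σ² t² / 2)` for all real `t`. -/
def IsSubGaussianVector {Ω : Type*} [MeasurableSpace Ω] {n : ℕ} (P : Measure Ω) (σ : ℝ≥0)
    (V : Ω → EuclideanSpace ℝ (Fin n)) : Prop :=
  ∀ a : EuclideanSpace ℝ (Fin n), ‖a‖ = 1 →
    HasSubgaussianMGF (fun ω => inner ℝ a (V ω) - ∫ ω', inner ℝ a (V ω') ∂P) (σ ^ 2) P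

/-- `c` is an admissible constant in the two-sided bound for the singular values of random matrices
with independent sub-Gaussian isotropic rows: for every `n × M` random matrix `Z` whose rows are
independent centred `ρ`-sub-Gaussian random vectors with identity covariance and for every `t ≥ 0`,
with probability at least `1 - 2 exp (-t)`,
`√n - c ρ² (√M + √t) ≤ σ_min(Z) ≤ σ_max(Z) ≤ √n + c ρ² (√M + √t)`.
The bounds on the extreme singular values (the minimum and the maximum of `‖Z v‖` over unit
vectors `v`) are spelled out on all unit vectors. -/
def IsSingularValueConst (c : ℝ) : Prop :=
  ∀ (n M : ℕ) (Ω : Type) [MeasurableSpace Ω] (P : Measure Ω) [IsProbabilityMeasure P] (ρ : ℝ≥0)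
    (row : Fin n → Ω → EuclideanSpace ℝ (Fin M)),
    (∀ i, Measurable (row i)) →
    iIndepFun row P →
    (∀ i, ∫ ω, row i ω ∂P = 0) →
    (∀ i, covMat P (row i) = 1) →
    (∀ i, IsSubGaussianVector P ρ (row i)) →
    ∀ t : ℝ, 0 ≤ t →
      1 - 2 * Real.exp (-t) ≤
        P.real {ω | ∀ v : EuclideanSpace ℝ (Fin M), ‖v‖ = 1 →
          √(n : ℝ) - c * (ρ : ℝ) ^ 2 * (√(M : ℝ) + √t)
              ≤ ‖mulEuc (Matrix.of fun i j => row i ω j) v‖ ∧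
            ‖mulEuc (Matrix.of fun i j => row i ω j) v‖
              ≤ √(n : ℝ) + c * (ρ : ℝ) ^ 2 * (√(M : ℝ) + √t)}

/-- The matrix `(Aᵀ C_ZZ⁻¹ A + C_XX⁻¹)⁻¹ Aᵀ C_ZZ⁻¹` of the linear minimum mean squared error
estimator for the model `Y = A X + Z`. -/
def lmmseMat {M N : ℕ} (A : Matrix (Fin M) (Fin N) ℝ) (CXX : Matrix (Fin N) (Fin N) ℝ)
    (CZZ : Matrix (Fin M) (Fin M) ℝ) : Matrix (Fin N) (Fin M) ℝ :=
  (A.transpose * CZZ⁻¹ * A + CXX⁻¹)⁻¹ * A.transpose * CZZ⁻¹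

/-- The matrix `C_EE = C_XX - C_XX Aᵀ (A C_XX Aᵀ + C_ZZ)⁻¹ A C_XX`, whose trace is the mean squared
error of the linear minimum mean squared error estimator. -/
def errCov {M N : ℕ} (A : Matrix (Fin M) (Fin N) ℝ) (CXX : Matrix (Fin N) (Fin N) ℝ)
    (CZZ : Matrix (Fin M) (Fin M) ℝ) : Matrix (Fin N) (Fin N) ℝ :=
  CXX - CXX * A.transpose * (A * CXX * A.transpose + CZZ)⁻¹ * A * CXX

/-- The mean squared error `𝔼_{X,Y} ‖f(Y) - X‖²` of a fixed estimator `f`. -/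
def mse {Ω : Type*} [MeasurableSpace Ω] {M N : ℕ} (P : Measure Ω)
    (X : Ω → EuclideanSpace ℝ (Fin N)) (Y : Ω → EuclideanSpace ℝ (Fin M))
    (f : EuclideanSpace ℝ (Fin M) → EuclideanSpace ℝ (Fin N)) : ℝ :=
  ∫ ω, ‖f (Y ω) - X ω‖ ^ 2 ∂P

/-- The empirical mean squared error `(1/n) ∑ ‖f(yᵢ) - xᵢ‖²`. -/
def empMse {M N n : ℕ} (x : Fin n → EuclideanSpace ℝ (Fin N))
    (y : Fin n → EuclideanSpace ℝ (Fin M))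
    (f : EuclideanSpace ℝ (Fin M) → EuclideanSpace ℝ (Fin N)) : ℝ :=
  (1 / (n : ℝ)) * ∑ i, ‖f (y i) - x i‖ ^ 2

/-- The linear map `f` minimizes the empirical mean squared error among all linear maps. -/
def IsEmpMinimizer {M N n : ℕ} (x : Fin n → EuclideanSpace ℝ (Fin N))
    (y : Fin n → EuclideanSpace ℝ (Fin M))
    (f : EuclideanSpace ℝ (Fin M) →ₗ[ℝ] EuclideanSpace ℝ (Fin N)) : Prop :=
  ∀ g : EuclideanSpace ℝ (Fin M) →ₗ[ℝ] EuclideanSpace ℝ (Fin N), empMse x y f ≤ empMse x y g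

/-- The linear map `f` is the least squares estimator of the samples `(xᵢ, yᵢ)`: the unique
minimizer of the empirical mean squared error among all linear maps. -/
def IsLeastSquaresEstimator {M N n : ℕ} (x : Fin n → EuclideanSpace ℝ (Fin N))
    (y : Fin n → EuclideanSpace ℝ (Fin M))
    (f : EuclideanSpace ℝ (Fin M) →ₗ[ℝ] EuclideanSpace ℝ (Fin N)) : Prop :=
  IsEmpMinimizer x y f ∧ ∀ g, IsEmpMinimizer x y g → g = f

/-- Conditional sub-Gaussianity of `E` given `Y` with companion matrix `C`: almost surely,
`𝔼 exp (αᵀ C^(-1/2) (E|Y - 𝔼[E|Y])) ≤ exp (‖α‖² / 2)` for all `α` (with the left side finite).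
The conditional law of `E` given `Y = y` is the regular conditional distribution. -/
def IsCondSubGaussian {Ω : Type*} [MeasurableSpace Ω] {M N : ℕ} (P : Measure Ω)
    [IsFiniteMeasure P] (C : Matrix (Fin N) (Fin N) ℝ) (E : Ω → EuclideanSpace ℝ (Fin N))
    (Y : Ω → EuclideanSpace ℝ (Fin M)) : Prop :=
  ∀ᵐ y ∂(P.map Y), ∀ α : EuclideanSpace ℝ (Fin N),
    Integrable (fun e => Real.exp (inner ℝ α
        (mulEuc (invSqrt C) (e - ∫ e', e' ∂(condDistrib E Y P y))))) (condDistrib E Y P y) ∧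
      ∫ e, Real.exp (inner ℝ α (mulEuc (invSqrt C) (e - ∫ e', e' ∂(condDistrib E Y P y))))
        ∂(condDistrib E Y P y) ≤ Real.exp (‖α‖ ^ 2 / 2)

/-- The number of samples
`(√((M tr C + 2 √(M tr(C²) ln(3/δ)) + 2 ‖C‖₂ ln(3/δ)) / (ε tr C_EE))
    + c ρ² (√M + √(ln(3/δ))))²`. -/
def sampleBound {N : ℕ} (M : ℕ) (C CEE : Matrix (Fin N) (Fin N) ℝ) (c ρ ε δ : ℝ) : ℝ :=
  (√((C.trace * M + 2 * √(M * (C ^ 2).trace * Real.log (3 / δ))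
        + 2 * specNorm C * Real.log (3 / δ)) / (CEE.trace * ε))
      + c * ρ ^ 2 * (√(M : ℝ) + √(Real.log (3 / δ)))) ^ 2

end

/-!
Conditionally on the data, least squares is a fixed design regression: with the whitened design
matrix `W` (rows `C_YY^(-1/2) yᵢ`) and the noise matrix `E` (rows `eᵢ = xᵢ - f_LMMSE(yᵢ)`), the least
squares estimator is `f_LMMSE + Eᵀ W (Wᵀ W)⁻¹ C_YY^(-1/2)` as soon as `Wᵀ W` is invertible. As the
error of the LMMSE estimator is uncorrelated with `Y`, the mean squared error of a linear estimator
`F` is `tr C_EE` plus the excess `tr ((F - f_LMMSE) C_YY (F - f_LMMSE)ᵀ)` (`mse_eq`), and for the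
least squares estimator this excess is `‖Eᵀ W (Wᵀ W)⁻¹‖_F²`. It is at most `σ_min(W)⁻²` times the energy
`tr (Eᵀ W (Wᵀ W)⁻¹ Wᵀ E)` of the projection of the noise onto the column space of `W`
(`exists_leastSquaresEstimator`). Two events of probability at least `1 - 2δ/3` and `1 - δ/3` bound
the two factors.

* The admissible constant bounds `σ_min(W)` from below (`le_measureReal_designMat`).
* Given the data, the projected noise is an `M N`-dimensional sub-Gaussian vector with covariance
  proxy `1 ⊗ C`, so its squared norm obeys the tail inequality of Hsu, Kakade and Zhang
  (`measure_sum_sq_ge_le`). That inequality follows by linearizing the square with an independent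
  Gaussian vector and evaluating a Gaussian integral. To condition on all data at once, the law of
  the samples is written as a product of laws of `Y` followed by a product of conditional laws of
  the error (`pi_compProd_eq_map`).

An admissible constant exists (`isSingularValueConst`): for a unit vector `v`, the variable
`‖W v‖² - n` is a sum of independent centred sub-exponential variables, to which Bernstein's
inequality applies; a union bound over a `1/2`-net of the sphere and a polarization argument extend
the bound to all unit vectors.
-/

open scoped ENNReal Matrix

/-! ### Quadratic forms of sub-Gaussian vectors -/

theorem lintegral_exp_mul_gaussianReal (s : ℝ) :
    ∫⁻ g, ENNReal.ofReal (Real.exp (s * g)) ∂(gaussianReal 0 1) =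
      ENNReal.ofReal (Real.exp (s ^ 2 / 2)) := by
  rw [← ofReal_integral_eq_lintegral_ofReal (integrable_exp_mul_gaussianReal s)
    (ae_of_all _ fun _ => (Real.exp_pos _).le)]
  have h := congrFun (mgf_id_gaussianReal (μ := 0) (v := 1)) s
  simp only [mgf, id] at h
  rw [h]
  simp

theorem lintegral_exp_mul_sq_gaussianReal {a : ℝ} (ha : a < 1 / 2) :
    ∫⁻ g, ENNReal.ofReal (Real.exp (a * g ^ 2)) ∂(gaussianReal 0 1) =
      ENNReal.ofReal ((√(1 - 2 * a))⁻¹) := by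
  have hb : 0 < 1 / 2 - a := by linarith
  rw [gaussianReal_of_var_ne_zero _ one_ne_zero,
    lintegral_withDensity_eq_lintegral_mul _ (measurable_gaussianPDF _ _) (by fun_prop)]
  have h : ∀ g : ℝ, (gaussianPDF 0 1 * fun g => ENNReal.ofReal (Real.exp (a * g ^ 2))) g =
      ENNReal.ofReal ((√(2 * Real.pi))⁻¹ * Real.exp (-(1 / 2 - a) * g ^ 2)) := by
    intro g
    simp only [Pi.mul_apply, gaussianPDF, gaussianPDFReal]
    rw [← ENNReal.ofReal_mul (by positivity), mul_assoc, ← Real.exp_add]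
    congr 3
    · simp
    · simp; ring
  simp_rw [h]
  rw [← ofReal_integral_eq_lintegral_ofReal ((integrable_exp_neg_mul_sq hb).const_mul _)
    (ae_of_all _ fun _ => by positivity), integral_const_mul, integral_gaussian,
    ← Real.sqrt_inv, ← Real.sqrt_inv, ← Real.sqrt_mul (by positivity)]
  congr 2
  field_simp

/-- With `x = -log √(1 - 2a)` this is the inequality `2 x ≤ sinh (2 x)`. -/
theorem inv_sqrt_one_sub_le_exp {a : ℝ} (ha0 : 0 ≤ a) (ha : a < 1 / 2) :
    (√(1 - 2 * a))⁻¹ ≤ Real.exp (a + a ^ 2 / (1 - 2 * a)) := by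
  have hpos : 0 < 1 - 2 * a := by linarith
  have hlog : Real.log (1 - 2 * a) ≤ 0 := Real.log_nonpos hpos.le (by linarith)
  have h := Real.self_le_sinh_iff.2 (neg_nonneg.2 hlog)
  rw [Real.sinh_eq, neg_neg, Real.exp_neg, Real.exp_log hpos] at h
  rw [← Real.exp_log (inv_pos.2 (Real.sqrt_pos.2 hpos)), Real.log_inv, Real.log_sqrt hpos.le]
  apply Real.exp_le_exp.2
  have e : a + a ^ 2 / (1 - 2 * a) = ((1 - 2 * a)⁻¹ - (1 - 2 * a)) / 2 / 2 := by
    have hne := hpos.ne'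
    rw [add_div' _ _ _ hne, inv_eq_one_div, div_sub' hne]
    field_simp
    ring
  rw [e]
  linarith

theorem lintegral_exp_mul_sq_gaussianReal_le {a : ℝ} (ha0 : 0 ≤ a) (ha : a < 1 / 2) :
    ∫⁻ g, ENNReal.ofReal (Real.exp (a * g ^ 2)) ∂(gaussianReal 0 1) ≤
      ENNReal.ofReal (Real.exp (a + a ^ 2 / (1 - 2 * a))) := by
  rw [lintegral_exp_mul_sq_gaussianReal ha]
  exact ENNReal.ofReal_le_ofReal (inv_sqrt_one_sub_le_exp ha0 ha)

theorem lintegral_pi_prod_eq_prod_lintegral {ι : Type*} [Fintype ι] {α : ι → Type*}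
    [∀ i, MeasurableSpace (α i)] (μ : ∀ i, Measure (α i)) [∀ i, IsProbabilityMeasure (μ i)]
    (f : ∀ i, α i → ℝ≥0∞) (hf : ∀ i, Measurable (f i)) :
    ∫⁻ x, ∏ i, f i (x i) ∂(Measure.pi μ) = ∏ i, ∫⁻ x, f i x ∂(μ i) := by
  rw [lintegral_prod_eq_prod_lintegral_of_indepFun Finset.univ (fun i (x : ∀ i, α i) => f i (x i))
    (iIndepFun_pi fun i => (hf i).aemeasurable) (fun i => (hf i).comp (measurable_pi_apply i))]
  refine Finset.prod_congr rfl fun i _ => ?_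
  exact (measurePreserving_eval μ i).lintegral_comp (hf i)

theorem ofReal_exp_sum {ι : Type*} [Fintype ι] (u : ι → ℝ) :
    ENNReal.ofReal (Real.exp (∑ k, u k)) = ∏ k, ENNReal.ofReal (Real.exp (u k)) := by
  rw [Real.exp_sum, ENNReal.ofReal_prod_of_nonneg fun _ _ => (Real.exp_pos _).le]

/-- Decoupling: a square is linearized by an independent standard Gaussian vector, which turns a
bound on linear exponential moments into a bound on quadratic ones. -/
theorem lintegral_exp_sum_sq_le {Ω ι : Type*} [MeasurableSpace Ω] [Fintype ι] {Q : Measure Ω}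
    [SFinite Q] {ξ : Ω → ι → ℝ} (hξ : Measurable ξ) {lam : ι → ℝ} (hlam : ∀ k, 0 ≤ lam k)
    (hsub : ∀ z : ι → ℝ, ∫⁻ ω, ENNReal.ofReal (Real.exp (∑ k, z k * ξ ω k)) ∂Q ≤
      ENNReal.ofReal (Real.exp ((∑ k, lam k * z k ^ 2) / 2)))
    {b η : ℝ} (hb : ∀ k, lam k ≤ b) (hη : 0 ≤ η) (hηb : 2 * η * b < 1) :
    ∫⁻ ω, ENNReal.ofReal (Real.exp (η * ∑ k, ξ ω k ^ 2)) ∂Q ≤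
      ENNReal.ofReal (Real.exp (η * ∑ k, lam k + η ^ 2 * (∑ k, lam k ^ 2) / (1 - 2 * η * b))) := by
  set γ : Measure (ι → ℝ) := Measure.pi fun _ => gaussianReal 0 1 with hγ
  have h1 : ∀ ω, ENNReal.ofReal (Real.exp (η * ∑ k, ξ ω k ^ 2)) =
      ∫⁻ g, ENNReal.ofReal (Real.exp (∑ k, (√(2 * η) * g k) * ξ ω k)) ∂γ := by
    intro ω
    simp_rw [ofReal_exp_sum]
    rw [lintegral_pi_prod_eq_prod_lintegral (fun _ => gaussianReal 0 1)
      (fun k g => ENNReal.ofReal (Real.exp ((√(2 * η) * g) * ξ ω k))) (fun k => by fun_prop),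
      Finset.mul_sum, ofReal_exp_sum]
    refine Finset.prod_congr rfl fun k _ => ?_
    have := lintegral_exp_mul_gaussianReal (√(2 * η) * ξ ω k)
    rw [mul_pow, Real.sq_sqrt (by positivity)] at this
    calc _ = ENNReal.ofReal (Real.exp (2 * η * ξ ω k ^ 2 / 2)) := by congr 2; ring
      _ = _ := by rw [← this]; congr 1; ext g; congr 2; ring
  have hfac : ∀ k, η * lam k < 1 / 2 := fun k => by nlinarith [hb k]
  calc _ = ∫⁻ ω, ∫⁻ g, ENNReal.ofReal (Real.exp (∑ k, (√(2 * η) * g k) * ξ ω k)) ∂γ ∂Q := by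
        simp_rw [h1]
    _ = ∫⁻ g, ∫⁻ ω, ENNReal.ofReal (Real.exp (∑ k, (√(2 * η) * g k) * ξ ω k)) ∂Q ∂γ := by
        apply lintegral_lintegral_swap
        apply Measurable.aemeasurable
        have : ∀ k, Measurable fun p : Ω × (ι → ℝ) => ξ p.1 k := fun k =>
          (measurable_pi_apply k).comp (hξ.comp measurable_fst)
        simp only [Function.uncurry_def]
        fun_prop
    _ ≤ ∫⁻ g, ENNReal.ofReal (Real.exp (∑ k, (η * lam k) * g k ^ 2)) ∂γ := by
        refine lintegral_mono fun g => (hsub _).trans (le_of_eq ?_)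
        congr 2
        rw [Finset.sum_div]
        refine Finset.sum_congr rfl fun k _ => ?_
        rw [mul_pow, Real.sq_sqrt (by positivity)]
        ring
    _ = ∏ k, ∫⁻ g, ENNReal.ofReal (Real.exp ((η * lam k) * g ^ 2)) ∂(gaussianReal 0 1) := by
        simp_rw [ofReal_exp_sum]
        exact lintegral_pi_prod_eq_prod_lintegral (fun _ => gaussianReal 0 1)
          (fun k g => ENNReal.ofReal (Real.exp ((η * lam k) * g ^ 2))) (fun k => by fun_prop)
    _ ≤ ∏ k, ENNReal.ofReal (Real.exp (η * lam k + η ^ 2 * lam k ^ 2 / (1 - 2 * η * b))) := by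
        refine Finset.prod_le_prod' fun k _ => ?_
        refine (lintegral_exp_mul_sq_gaussianReal_le (mul_nonneg hη (hlam k)) (hfac k)).trans ?_
        refine ENNReal.ofReal_le_ofReal (Real.exp_le_exp.2 ?_)
        rw [mul_pow]
        have : 1 - 2 * η * b ≤ 1 - 2 * (η * lam k) := by nlinarith [hb k]
        gcongr
    _ = _ := by
        rw [← ofReal_exp_sum, Finset.sum_add_distrib, ← Finset.mul_sum, ← Finset.sum_div, ← Finset.mul_sum]

/-- The tail inequality of Hsu, Kakade and Zhang for quadratic forms of sub-Gaussian vectors, in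
diagonalized form. -/
theorem measure_sum_sq_ge_le {Ω ι : Type*} [MeasurableSpace Ω] [Fintype ι] {Q : Measure Ω}
    [SFinite Q] {ξ : Ω → ι → ℝ} (hξ : Measurable ξ) {lam : ι → ℝ} (hlam : ∀ k, 0 ≤ lam k)
    (hsub : ∀ z : ι → ℝ, ∫⁻ ω, ENNReal.ofReal (Real.exp (∑ k, z k * ξ ω k)) ∂Q ≤
      ENNReal.ofReal (Real.exp ((∑ k, lam k * z k ^ 2) / 2)))
    {b t : ℝ} (hb0 : 0 ≤ b) (hb : ∀ k, lam k ≤ b) (ht : 0 < t) (hv : 0 < ∑ k, lam k ^ 2) :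
    Q {ω | ∑ k, lam k + 2 * √((∑ k, lam k ^ 2) * t) + 2 * b * t ≤ ∑ k, ξ ω k ^ 2} ≤
      ENNReal.ofReal (Real.exp (-t)) := by
  set v := ∑ k, lam k ^ 2
  set r := √t with hr
  set w := √v with hw
  have hr0 : 0 < r := Real.sqrt_pos.2 ht
  have hw0 : 0 < w := Real.sqrt_pos.2 hv
  have hrt : t = r ^ 2 := (Real.sq_sqrt ht.le).symm
  have hwv : v = w ^ 2 := (Real.sq_sqrt hv.le).symm
  have hd : 0 < w + 2 * b * r := by positivity
  -- the minimizer of the Chernoff bound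
  set η := r / (w + 2 * b * r) with hη
  have hη0 : 0 < η := by positivity
  have h1 : 1 - 2 * η * b = w / (w + 2 * b * r) := by rw [hη]; field_simp; ring
  have hηb : 2 * η * b < 1 := by
    have : 0 < w / (w + 2 * b * r) := by positivity
    linarith
  set s := ∑ k, lam k + 2 * √(v * t) + 2 * b * t with hs
  have hmgf := lintegral_exp_sum_sq_le hξ hlam hsub hb hη0.le hηb
  have hsub : {ω | s ≤ ∑ k, ξ ω k ^ 2} ⊆ {ω | ENNReal.ofReal (Real.exp (η * s)) ≤
      ENNReal.ofReal (Real.exp (η * ∑ k, ξ ω k ^ 2))} := fun ω hω =>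
    ENNReal.ofReal_le_ofReal (Real.exp_le_exp.2 (mul_le_mul_of_nonneg_left hω hη0.le))
  have hm : Measurable fun ω => ENNReal.ofReal (Real.exp (η * ∑ k, ξ ω k ^ 2)) := by
    have : ∀ k, Measurable fun ω => ξ ω k := fun k => (measurable_pi_apply k).comp hξ
    fun_prop
  refine (measure_mono hsub).trans ((meas_ge_le_lintegral_div hm.aemeasurable
    (by simpa using Real.exp_pos _) ENNReal.ofReal_ne_top).trans ?_)
  refine (ENNReal.div_le_div_right hmgf _).trans ?_
  rw [← ENNReal.ofReal_div_of_pos (Real.exp_pos _), ← Real.exp_sub]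
  refine ENNReal.ofReal_le_ofReal (Real.exp_le_exp.2 (le_of_eq ?_))
  rw [hs, Real.sqrt_mul hv.le, ← hr, ← hw, h1]
  change η * _ + η ^ 2 * v / _ - _ = _
  rw [hη, hrt, hwv]
  field_simp
  ring

/-! ### Sampling pairs through conditional distributions -/

/-- The product kernel `y ↦ ⨂ᵢ κ (y i)`. -/
noncomputable def ProbabilityTheory.Kernel.piConst {ι α β : Type*} [Fintype ι] [MeasurableSpace α]
    [MeasurableSpace β] (κ : Kernel α β) [IsMarkovKernel κ] : Kernel (ι → α) (ι → β) where
  toFun y := Measure.pi fun i => κ (y i)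
  measurable' := by
    refine Measurable.measure_of_isPiSystem_of_isProbabilityMeasure generateFrom_pi.symm
      isPiSystem_pi ?_
    rintro _ ⟨s, hs, rfl⟩
    simp_rw [Measure.pi_pi]
    refine Finset.measurable_prod _ fun i _ => ?_
    exact (κ.measurable_coe (hs i (Set.mem_univ i))).comp (measurable_pi_apply i)

instance {ι α β : Type*} [Fintype ι] [MeasurableSpace α] [MeasurableSpace β] (κ : Kernel α β)
    [IsMarkovKernel κ] : IsMarkovKernel (κ.piConst : Kernel (ι → α) (ι → β)) :=
  ⟨fun y => inferInstanceAs (IsProbabilityMeasure (Measure.pi fun i => κ (y i)))⟩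

/-- Independent copies of a pair can be sampled by first drawing all first components, then drawing
the second components independently from the conditional distributions. -/
theorem pi_compProd_eq_map {ι α β : Type*} [Fintype ι] [MeasurableSpace α] [MeasurableSpace β]
    (ν : Measure α) [IsProbabilityMeasure ν] (κ : Kernel α β) [IsMarkovKernel κ] :
    Measure.pi (fun _ : ι => ν ⊗ₘ κ) =
      ((Measure.pi fun _ : ι => ν) ⊗ₘ κ.piConst).map fun p i => (p.1 i, p.2 i) := by
  have hz : Measurable fun (p : (ι → α) × (ι → β)) i => (p.1 i, p.2 i) := by fun_prop
  refine Measure.pi_eq fun s hs => ?_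
  rw [Measure.map_apply hz (MeasurableSet.univ_pi hs),
    Measure.compProd_apply (hz (MeasurableSet.univ_pi hs))]
  have h : ∀ y : ι → α, (κ.piConst y : Measure (ι → β)) (Prod.mk y ⁻¹'
      ((fun (p : (ι → α) × (ι → β)) i => (p.1 i, p.2 i)) ⁻¹' Set.univ.pi s)) =
      ∏ i, κ (y i) (Prod.mk (y i) ⁻¹' s i) := by
    intro y
    change (Measure.pi fun i => κ (y i)) _ = _
    rw [← Measure.pi_pi]
    congr 1
  simp_rw [h]
  rw [lintegral_pi_prod_eq_prod_lintegral (fun _ : ι => ν)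
    (fun i a => κ a (Prod.mk a ⁻¹' s i)) fun i => Kernel.measurable_kernel_prodMk_left (hs i)]
  exact Finset.prod_congr rfl fun i _ => (Measure.compProd_apply (hs i)).symm

theorem measure_pi_compProd_le {ι α β : Type*} [Fintype ι] [MeasurableSpace α] [MeasurableSpace β]
    {ν : Measure α} [IsProbabilityMeasure ν] {κ : Kernel α β} [IsMarkovKernel κ] {p : α → Prop}
    (hp : ∀ᵐ a ∂ν, p a) {B : Set (ι → α × β)} (hB : MeasurableSet B) {c : ℝ≥0∞}
    (h : ∀ y : ι → α, (∀ i, p (y i)) →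
      (Measure.pi fun i => κ (y i)) {e | (fun i => (y i, e i)) ∈ B} ≤ c) :
    Measure.pi (fun _ : ι => ν ⊗ₘ κ) B ≤ c := by
  have hz : Measurable fun (p : (ι → α) × (ι → β)) i => (p.1 i, p.2 i) := by fun_prop
  rw [pi_compProd_eq_map, Measure.map_apply hz hB, Measure.compProd_apply (hz hB)]
  have hp' : ∀ᵐ y ∂(Measure.pi fun _ : ι => ν), ∀ i, p (y i) := ae_all_iff.2 fun i =>
    (measurePreserving_eval (fun _ : ι => ν) i).quasiMeasurePreserving.ae hp
  calc _ ≤ ∫⁻ _, c ∂(Measure.pi fun _ : ι => ν) :=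
        lintegral_mono_ae (hp'.mono fun y hy => h y hy)
    _ = c := by simp

/-! ### Projected noise for a fixed design -/

section Matrices

theorem transpose_eq_of_posDef {n : ℕ} {C : Matrix (Fin n) (Fin n) ℝ} (hC : C.PosDef) :
    Cᵀ = C := by
  have := hC.isHermitian
  rwa [Matrix.IsHermitian, Matrix.conjTranspose_eq_transpose_of_trivial] at this

open scoped MatrixOrder in
theorem sqrt_mul_sqrt {n : ℕ} {C : Matrix (Fin n) (Fin n) ℝ} (hC : C.PosDef) :
    CFC.sqrt C * CFC.sqrt C = C :=
  CFC.sqrt_mul_sqrt_self C (Matrix.nonneg_iff_posSemidef.2 hC.posSemidef)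

open scoped MatrixOrder in
theorem transpose_sqrt {n : ℕ} (C : Matrix (Fin n) (Fin n) ℝ) :
    (CFC.sqrt C)ᵀ = CFC.sqrt C := by
  have h := (Matrix.nonneg_iff_posSemidef.1 (CFC.sqrt_nonneg C)).isHermitian
  rwa [Matrix.IsHermitian, Matrix.conjTranspose_eq_transpose_of_trivial] at h

theorem transpose_invSqrt {n : ℕ} (C : Matrix (Fin n) (Fin n) ℝ) :
    (invSqrt C)ᵀ = invSqrt C := by
  rw [invSqrt, Matrix.transpose_nonsing_inv, transpose_sqrt]

open scoped MatrixOrder in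
theorem isUnit_det_sqrt {n : ℕ} {C : Matrix (Fin n) (Fin n) ℝ} (hC : C.PosDef) :
    IsUnit (CFC.sqrt C).det := by
  have h := (Matrix.isUnit_iff_isUnit_det C).1 hC.isUnit
  rw [← sqrt_mul_sqrt hC, Matrix.det_mul] at h
  exact isUnit_of_mul_isUnit_left h

theorem invSqrt_mul_self {n : ℕ} {C : Matrix (Fin n) (Fin n) ℝ} (hC : C.PosDef) :
    invSqrt C * invSqrt C = C⁻¹ := by
  rw [invSqrt, ← Matrix.mul_inv_rev, sqrt_mul_sqrt hC]

open scoped MatrixOrder in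
theorem invSqrt_mul_mul_invSqrt {n : ℕ} {C : Matrix (Fin n) (Fin n) ℝ} (hC : C.PosDef) :
    invSqrt C * C * invSqrt C = 1 := by
  have h := isUnit_det_sqrt hC
  calc invSqrt C * C * invSqrt C
      = invSqrt C * (CFC.sqrt C * CFC.sqrt C) * invSqrt C := by rw [sqrt_mul_sqrt hC]
    _ = (invSqrt C * CFC.sqrt C) * (CFC.sqrt C * invSqrt C) := by simp only [Matrix.mul_assoc]
    _ = 1 := by rw [invSqrt, Matrix.nonsing_inv_mul _ h, Matrix.mul_nonsing_inv _ h, one_mul]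

theorem inner_eq_dotProduct {n : ℕ} (x y : EuclideanSpace ℝ (Fin n)) :
    inner ℝ x y = x.ofLp ⬝ᵥ y.ofLp := by
  rw [EuclideanSpace.inner_eq_star_dotProduct, dotProduct_comm]
  rfl

theorem norm_sq_eq_dotProduct {n : ℕ} (x : EuclideanSpace ℝ (Fin n)) :
    ‖x‖ ^ 2 = x.ofLp ⬝ᵥ x.ofLp := by
  rw [← inner_eq_dotProduct, real_inner_self_eq_norm_sq]

theorem ofLp_mulEuc {m n : ℕ} (A : Matrix (Fin m) (Fin n) ℝ) (v : EuclideanSpace ℝ (Fin n)) :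
    (mulEuc A v).ofLp = A *ᵥ v.ofLp := rfl

theorem trace_transpose_mul {m n : Type*} [Fintype m] [Fintype n] (A B : Matrix m n ℝ) :
    (Aᵀ * B).trace = ∑ i, A i ⬝ᵥ B i := by
  simp only [Matrix.trace, Matrix.diag, Matrix.mul_apply, Matrix.transpose_apply, dotProduct]
  exact Finset.sum_comm

/-- The columns of the matrix are an orthonormal eigenbasis of `C`. -/
theorem exists_orthogonal_diagonalization {n : ℕ} {C : Matrix (Fin n) (Fin n) ℝ}
    (hC : C.PosDef) : ∃ (B : Matrix (Fin n) (Fin n) ℝ) (lam : Fin n → ℝ),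
      B * Bᵀ = 1 ∧ Bᵀ * C * B = Matrix.diagonal lam ∧ (∀ k, 0 < lam k) ∧
      (∀ k, lam k ≤ specNorm C) ∧ C.trace = ∑ k, lam k ∧ (C ^ 2).trace = ∑ k, lam k ^ 2 := by
  have hH := hC.isHermitian
  set B : Matrix (Fin n) (Fin n) ℝ := hH.eigenvectorUnitary.1 with hB
  have hBB : B * Bᵀ = 1 := by
    have := Unitary.coe_mul_star_self hH.eigenvectorUnitary
    rwa [Unitary.coe_star, Matrix.star_eq_conjTranspose, Matrix.conjTranspose_eq_transpose_of_trivial] at this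
  have hspec : C = B * Matrix.diagonal hH.eigenvalues * Bᵀ := by
    have := hH.spectral_theorem
    rwa [Unitary.conjStarAlgAut_apply, Matrix.star_eq_conjTranspose,
      Matrix.conjTranspose_eq_transpose_of_trivial] at this
  have hBB' : Bᵀ * B = 1 := mul_eq_one_comm.1 hBB
  have hdiag : Bᵀ * C * B = Matrix.diagonal hH.eigenvalues := by
    conv_lhs => rw [hspec]
    calc _ = (Bᵀ * B) * Matrix.diagonal hH.eigenvalues * (Bᵀ * B) := by
          simp only [Matrix.mul_assoc]
      _ = _ := by rw [hBB', Matrix.one_mul, Matrix.mul_one]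
  refine ⟨B, hH.eigenvalues, hBB, hdiag, fun k => hC.eigenvalues_pos k, fun k => ?_, ?_, ?_⟩
  · have h1 : Matrix.toEuclideanCLM (n := Fin n) (𝕜 := ℝ) C (hH.eigenvectorBasis k) =
        hH.eigenvalues k • hH.eigenvectorBasis k := by
      apply WithLp.ofLp_injective 2
      exact hH.mulVec_eigenvectorBasis k
    have h2 := (Matrix.toEuclideanCLM (n := Fin n) (𝕜 := ℝ) C).le_opNorm (hH.eigenvectorBasis k)
    rw [h1, norm_smul, hH.eigenvectorBasis.orthonormal.1 k, mul_one, mul_one] at h2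
    exact (le_abs_self _).trans h2
  · simpa using hH.trace_eq_sum_eigenvalues
  · have : C ^ 2 = B * (Matrix.diagonal hH.eigenvalues * Matrix.diagonal hH.eigenvalues) * Bᵀ := by
      rw [sq]
      conv_lhs => rw [hspec]
      calc _ = B * Matrix.diagonal hH.eigenvalues * (Bᵀ * B) *
            (Matrix.diagonal hH.eigenvalues * Bᵀ) := by simp only [Matrix.mul_assoc]
        _ = _ := by rw [hBB', Matrix.mul_one]; simp only [Matrix.mul_assoc]
    rw [this, Matrix.trace_mul_comm, ← Matrix.mul_assoc, hBB', Matrix.one_mul,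
      Matrix.diagonal_mul_diagonal, Matrix.trace_diagonal]
    exact Finset.sum_congr rfl fun k _ => (sq _).symm

/-- The columns of the matrix `U` are an orthonormal basis of the column space of `W`. -/
theorem exists_orthonormal_columns {m n : ℕ} (W : Matrix (Fin n) (Fin m) ℝ)
    (hW : (Wᵀ * W).det ≠ 0) : ∃ U : Matrix (Fin n) (Fin m) ℝ,
      Uᵀ * U = 1 ∧ U * Uᵀ = W * (Wᵀ * W)⁻¹ * Wᵀ := by
  have hpsd : (Wᵀ * W).PosSemidef := by
    simpa [Matrix.conjTranspose_eq_transpose_of_trivial] using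
      Matrix.posSemidef_conjTranspose_mul_self W
  have hpd : (Wᵀ * W).PosDef := hpsd.posDef_iff_det_ne_zero.2 hW
  refine ⟨W * invSqrt (Wᵀ * W), ?_, ?_⟩
  · rw [Matrix.transpose_mul, transpose_invSqrt, ← invSqrt_mul_mul_invSqrt hpd]
    simp only [Matrix.mul_assoc]
  · rw [Matrix.transpose_mul, transpose_invSqrt, ← invSqrt_mul_self hpd]
    simp only [Matrix.mul_assoc]

end Matrices

section FixedDesign

theorem lintegral_pi_exp_sum_inner_le {n N : ℕ} {C : Matrix (Fin N) (Fin N) ℝ}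
    (κ : Fin n → Measure (EuclideanSpace ℝ (Fin N))) [∀ i, IsProbabilityMeasure (κ i)]
    (hκ : ∀ i, ∀ β : EuclideanSpace ℝ (Fin N),
      ∫⁻ e, ENNReal.ofReal (Real.exp (inner ℝ β e)) ∂(κ i) ≤
        ENNReal.ofReal (Real.exp (β.ofLp ⬝ᵥ C *ᵥ β.ofLp / 2)))
    (b : Fin n → EuclideanSpace ℝ (Fin N)) :
    ∫⁻ e, ENNReal.ofReal (Real.exp (∑ i, inner ℝ (b i) (e i))) ∂(Measure.pi κ) ≤
      ENNReal.ofReal (Real.exp ((∑ i, (b i).ofLp ⬝ᵥ C *ᵥ (b i).ofLp) / 2)) := by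
  simp_rw [Finset.sum_div, ofReal_exp_sum]
  rw [lintegral_pi_prod_eq_prod_lintegral κ
    (fun i e => ENNReal.ofReal (Real.exp (inner ℝ (b i) e))) fun i => by fun_prop]
  exact Finset.prod_le_prod' fun i _ => hκ i _

/-- For a fixed design `W`, the energy `tr (Eᵀ W (Wᵀ W)⁻¹ Wᵀ E)` of the projection of the noise
matrix `E` onto the column space of `W` satisfies the tail bound of a quadratic form of a
sub-Gaussian vector with covariance `1 ⊗ C`. -/
theorem measure_projected_noise_ge_le {n M N : ℕ} [NeZero M] [NeZero N]
    {C : Matrix (Fin N) (Fin N) ℝ} (hC : C.PosDef)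
    (κ : Fin n → Measure (EuclideanSpace ℝ (Fin N))) [∀ i, IsProbabilityMeasure (κ i)]
    (hκ : ∀ i, ∀ β : EuclideanSpace ℝ (Fin N),
      ∫⁻ e, ENNReal.ofReal (Real.exp (inner ℝ β e)) ∂(κ i) ≤
        ENNReal.ofReal (Real.exp (β.ofLp ⬝ᵥ C *ᵥ β.ofLp / 2)))
    (W : Matrix (Fin n) (Fin M) ℝ) (hW : (Wᵀ * W).det ≠ 0) {t : ℝ} (ht : 0 < t) :
    (Measure.pi κ) {e | C.trace * M + 2 * √(M * (C ^ 2).trace * t) + 2 * specNorm C * t ≤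
      ((Matrix.of fun i k => e i k)ᵀ * (W * (Wᵀ * W)⁻¹ * Wᵀ) *
        (Matrix.of fun i k => e i k)).trace} ≤ ENNReal.ofReal (Real.exp (-t)) := by
  obtain ⟨B, lam, hBB, hdiag, hlam, hspec, htr, htr2⟩ := exists_orthogonal_diagonalization hC
  obtain ⟨U, hU1, hU2⟩ := exists_orthonormal_columns W hW
  let Em : (Fin n → EuclideanSpace ℝ (Fin N)) → Matrix (Fin n) (Fin N) ℝ := fun e =>
    Matrix.of fun i k => e i k
  let ξ : (Fin n → EuclideanSpace ℝ (Fin N)) → Fin M × Fin N → ℝ := fun e p =>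
    (Uᵀ * Em e * B) p.1 p.2
  have hξ : Measurable ξ := by
    refine measurable_pi_iff.2 fun p => ?_
    have : ∀ i k, Measurable fun e : Fin n → EuclideanSpace ℝ (Fin N) => (e i).ofLp k :=
      fun i k => by fun_prop
    simp only [ξ, Em, Matrix.mul_apply, Matrix.of_apply]
    fun_prop
  have hsq : ∀ e, ∑ p, ξ e p ^ 2 = ((Em e)ᵀ * (W * (Wᵀ * W)⁻¹ * Wᵀ) * Em e).trace := by
    intro e
    rw [← hU2]
    calc ∑ p, ξ e p ^ 2 = ((Uᵀ * Em e * B)ᵀ * (Uᵀ * Em e * B)).trace := by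
          rw [trace_transpose_mul, Fintype.sum_prod_type]
          simp only [ξ, dotProduct, sq]
      _ = (Bᵀ * ((Em e)ᵀ * (U * Uᵀ) * Em e * B)).trace := by
          simp only [Matrix.transpose_mul, Matrix.transpose_transpose, Matrix.mul_assoc]
      _ = _ := by
          rw [Matrix.trace_mul_comm, Matrix.mul_assoc _ B, hBB, Matrix.mul_one]
  have hsub : ∀ z : Fin M × Fin N → ℝ,
      ∫⁻ e, ENNReal.ofReal (Real.exp (∑ p, z p * ξ e p)) ∂(Measure.pi κ) ≤
        ENNReal.ofReal (Real.exp ((∑ p, lam p.2 * z p ^ 2) / 2)) := by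
    intro z
    let Zm : Matrix (Fin M) (Fin N) ℝ := Matrix.of fun j k => z (j, k)
    let β : Matrix (Fin n) (Fin N) ℝ := U * Zm * Bᵀ
    have h1 : ∀ e, ∑ p, z p * ξ e p = ∑ i, inner ℝ (WithLp.toLp 2 (β i)) (e i) := by
      intro e
      calc ∑ p, z p * ξ e p = (Zmᵀ * (Uᵀ * Em e * B)).trace := by
            rw [trace_transpose_mul, Fintype.sum_prod_type]
            rfl
        _ = (βᵀ * Em e).trace := by
            simp only [β, Matrix.transpose_mul, Matrix.transpose_transpose]
            rw [← Matrix.mul_assoc, Matrix.trace_mul_comm]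
            simp only [Matrix.mul_assoc]
        _ = _ := by
            rw [trace_transpose_mul]
            simp only [inner_eq_dotProduct]
            rfl
    have h2 : ∑ i, β i ⬝ᵥ C *ᵥ β i = ∑ p : Fin M × Fin N, lam p.2 * z p ^ 2 := by
      have hCt : Cᵀ = C := transpose_eq_of_posDef hC
      calc ∑ i, β i ⬝ᵥ C *ᵥ β i = (βᵀ * (β * C)).trace := by
            rw [trace_transpose_mul]
            refine Finset.sum_congr rfl fun i _ => ?_
            congr 1
            rw [Matrix.mul_apply_eq_vecMul, ← Matrix.mulVec_transpose, hCt]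
        _ = (B * (Zmᵀ * (Uᵀ * U) * Zm * Bᵀ * C)).trace := by
            simp only [β, Matrix.transpose_mul, Matrix.transpose_transpose, Matrix.mul_assoc]
        _ = (Zmᵀ * (Zm * (Bᵀ * C * B))).trace := by
            rw [Matrix.trace_mul_comm, hU1, Matrix.mul_one]
            simp only [Matrix.mul_assoc]
        _ = _ := by
            rw [hdiag, trace_transpose_mul, Fintype.sum_prod_type]
            refine Finset.sum_congr rfl fun j _ => ?_
            simp only [dotProduct, Matrix.mul_diagonal]
            refine Finset.sum_congr rfl fun k _ => ?_
            simp only [Zm, Matrix.of_apply]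
            ring
    simp_rw [h1]
    refine (lintegral_pi_exp_sum_inner_le κ hκ _).trans (le_of_eq ?_)
    rw [← h2]
  have hpos : 0 < ∑ p : Fin M × Fin N, lam p.2 ^ 2 :=
    Finset.sum_pos (fun p _ => pow_pos (hlam _) 2) ⟨(0, 0), Finset.mem_univ _⟩
  have hmain := measure_sum_sq_ge_le hξ (lam := fun p => lam p.2) (fun p => (hlam _).le) hsub
    (b := specNorm C) (norm_nonneg _) (fun p => hspec _) ht hpos
  have hs1 : ∑ p : Fin M × Fin N, lam p.2 = C.trace * M := by
    rw [Fintype.sum_prod_type, htr]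
    simp [mul_comm]
  have hs2 : ∑ p : Fin M × Fin N, lam p.2 ^ 2 = M * (C ^ 2).trace := by
    rw [Fintype.sum_prod_type, htr2]
    simp
  simp_rw [hsq] at hmain
  rwa [hs1, hs2] at hmain

end FixedDesign

/-! ### Projected noise for a random design -/

section Measurability

theorem measurable_det {Ω m : Type*} [MeasurableSpace Ω] [Fintype m] [DecidableEq m]
    {A : Ω → Matrix m m ℝ} (hA : ∀ i j, Measurable fun ω => A ω i j) :
    Measurable fun ω => (A ω).det := by
  simp only [Matrix.det_apply]
  fun_prop

theorem measurable_matrix_inv {Ω m : Type*} [MeasurableSpace Ω] [Fintype m] [DecidableEq m]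
    {A : Ω → Matrix m m ℝ} (hA : ∀ i j, Measurable fun ω => A ω i j) (i j : m) :
    Measurable fun ω => (A ω)⁻¹ i j := by
  simp only [Matrix.inv_def, Matrix.smul_apply, Ring.inverse_eq_inv', Matrix.adjugate_apply,
    smul_eq_mul]
  refine (measurable_det hA).inv.mul (measurable_det fun k l => ?_)
  simp only [Matrix.updateRow_apply]
  split_ifs
  · exact measurable_const
  · exact hA k l

theorem measurable_mul_apply {Ω l m n : Type*} [MeasurableSpace Ω] [Fintype m]
    {A : Ω → Matrix l m ℝ} {B : Ω → Matrix m n ℝ} (hA : ∀ i j, Measurable fun ω => A ω i j)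
    (hB : ∀ i j, Measurable fun ω => B ω i j) (i : l) (j : n) :
    Measurable fun ω => (A ω * B ω) i j := by
  simp only [Matrix.mul_apply]
  fun_prop

end Measurability

section RandomDesign

variable {n M N : ℕ}

/-- The design matrix, whose rows are the whitened samples `R yᵢ`. -/
noncomputable def designMat (R : Matrix (Fin M) (Fin M) ℝ) (y : Fin n → EuclideanSpace ℝ (Fin M)) :
    Matrix (Fin n) (Fin M) ℝ :=
  Matrix.of fun i j => mulEuc R (y i) j

/-- The matrix whose rows are the vectors `eᵢ`. -/
def rowMat (e : Fin n → EuclideanSpace ℝ (Fin N)) : Matrix (Fin n) (Fin N) ℝ :=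
  Matrix.of fun i k => e i k

/-- The squared Frobenius norm of the projection of the noise matrix onto the column space of `W`
(if the columns of `W` are linearly independent). -/
noncomputable def projNoise (W : Matrix (Fin n) (Fin M) ℝ) (E : Matrix (Fin n) (Fin N) ℝ) : ℝ :=
  (Eᵀ * (W * (Wᵀ * W)⁻¹ * Wᵀ) * E).trace

theorem measurableSet_noise_event (R : Matrix (Fin M) (Fin M) ℝ) (K : ℝ) :
    MeasurableSet {z : Fin n → EuclideanSpace ℝ (Fin M) × EuclideanSpace ℝ (Fin N) |
      ((designMat R fun i => (z i).1)ᵀ * designMat R fun i => (z i).1).det ≠ 0 ∧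
      K ≤ projNoise (designMat R fun i => (z i).1) (rowMat fun i => (z i).2)} := by
  have hW : ∀ i j, Measurable fun z : Fin n → EuclideanSpace ℝ (Fin M) × EuclideanSpace ℝ (Fin N) =>
      (designMat R fun i => (z i).1) i j := by
    intro i j
    simp only [designMat, Matrix.of_apply, ofLp_mulEuc, Matrix.mulVec, dotProduct]
    fun_prop
  have hE : ∀ i j, Measurable fun z : Fin n → EuclideanSpace ℝ (Fin M) × EuclideanSpace ℝ (Fin N) =>
      (rowMat fun i => (z i).2) i j := by
    intro i j
    simp only [rowMat, Matrix.of_apply]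
    fun_prop
  have hS := measurable_mul_apply (fun i j => hW j i) hW
  have hq : Measurable fun z : Fin n → EuclideanSpace ℝ (Fin M) × EuclideanSpace ℝ (Fin N) =>
      projNoise (designMat R fun i => (z i).1) (rowMat fun i => (z i).2) := ?_
  · exact (measurableSet_eq_fun (measurable_det hS) measurable_const).compl.inter
      (measurableSet_le measurable_const hq)
  simp only [projNoise, Matrix.trace, Matrix.diag]
  refine Finset.measurable_sum _ fun k _ => ?_
  refine measurable_mul_apply (measurable_mul_apply (fun i j => hE j i) ?_) hE k k
  exact measurable_mul_apply (measurable_mul_apply hW (measurable_matrix_inv hS)) fun i j => hW j i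

open scoped MatrixOrder in
/-- If the error has conditional mean zero, conditional sub-Gaussianity bounds the conditional
moment generating function of the error itself. -/
theorem IsCondSubGaussian.ae_lintegral_exp_inner_le {Ω : Type*} [MeasurableSpace Ω] {P : Measure Ω}
    [IsProbabilityMeasure P] {C : Matrix (Fin N) (Fin N) ℝ} (hC : C.PosDef)
    {E : Ω → EuclideanSpace ℝ (Fin N)} {Y : Ω → EuclideanSpace ℝ (Fin M)}
    (h : IsCondSubGaussian P C E Y)
    (h0 : ∀ᵐ y ∂(P.map Y), ∫ e, e ∂(condDistrib E Y P y) = 0) :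
    ∀ᵐ y ∂(P.map Y), ∀ β : EuclideanSpace ℝ (Fin N),
      ∫⁻ e, ENNReal.ofReal (Real.exp (inner ℝ β e)) ∂(condDistrib E Y P y) ≤
        ENNReal.ofReal (Real.exp (β.ofLp ⬝ᵥ C *ᵥ β.ofLp / 2)) := by
  filter_upwards [h, h0] with y hy hy0 β
  obtain ⟨hint, hle⟩ := hy (mulEuc (CFC.sqrt C) β)
  simp only [hy0, sub_zero] at hint hle
  have h1 : ∀ e : EuclideanSpace ℝ (Fin N),
      inner ℝ (mulEuc (CFC.sqrt C) β) (mulEuc (invSqrt C) e) = inner ℝ β e := by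
    intro e
    rw [inner_eq_dotProduct, inner_eq_dotProduct, ofLp_mulEuc, ofLp_mulEuc,
      ← transpose_sqrt, Matrix.mulVec_transpose, ← Matrix.dotProduct_mulVec, Matrix.mulVec_mulVec,
      invSqrt, Matrix.mul_nonsing_inv _ (isUnit_det_sqrt hC), Matrix.one_mulVec]
  have h2 : ‖mulEuc (CFC.sqrt C) β‖ ^ 2 = β.ofLp ⬝ᵥ C *ᵥ β.ofLp := by
    rw [norm_sq_eq_dotProduct, ofLp_mulEuc]
    conv_lhs => enter [1]; rw [← transpose_sqrt, Matrix.mulVec_transpose]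
    rw [← Matrix.dotProduct_mulVec, Matrix.mulVec_mulVec, sqrt_mul_sqrt hC]
  simp only [h1, h2] at hint hle
  rw [← ofReal_integral_eq_lintegral_ofReal hint (ae_of_all _ fun _ => (Real.exp_pos _).le)]
  exact ENNReal.ofReal_le_ofReal hle

/-- The tail bound for the projected noise holds conditionally on the data, hence also for the joint
law of data and noise. -/
theorem measure_pi_noise_event_le [NeZero M] [NeZero N] {Ω : Type*} [MeasurableSpace Ω]
    {P : Measure Ω} [IsProbabilityMeasure P] {C : Matrix (Fin N) (Fin N) ℝ} (hC : C.PosDef)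
    {E : Ω → EuclideanSpace ℝ (Fin N)} {Y : Ω → EuclideanSpace ℝ (Fin M)}
    (hEm : Measurable E) (hYm : Measurable Y) (h : IsCondSubGaussian P C E Y)
    (h0 : ∀ᵐ y ∂(P.map Y), ∫ e, e ∂(condDistrib E Y P y) = 0)
    (R : Matrix (Fin M) (Fin M) ℝ) {t : ℝ} (ht : 0 < t) :
    Measure.pi (fun _ : Fin n => P.map fun ω => (Y ω, E ω)) {z |
      ((designMat R fun i => (z i).1)ᵀ * designMat R fun i => (z i).1).det ≠ 0 ∧
      C.trace * M + 2 * √(M * (C ^ 2).trace * t) + 2 * specNorm C * t ≤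
        projNoise (designMat R fun i => (z i).1) (rowMat fun i => (z i).2)} ≤
      ENNReal.ofReal (Real.exp (-t)) := by
  have := Measure.isProbabilityMeasure_map (μ := P) hYm.aemeasurable
  rw [← compProd_map_condDistrib (X := Y) hEm.aemeasurable]
  refine measure_pi_compProd_le (h.ae_lintegral_exp_inner_le hC h0)
    (measurableSet_noise_event R _) fun y hy => ?_
  by_cases hdet : ((designMat R y)ᵀ * designMat R y).det = 0
  · simp [hdet]
  · simp only [Set.mem_ofPred_eq, ne_eq, hdet, not_false_eq_true, true_and]
    exact measure_projected_noise_ge_le hC _ hy (designMat R y) hdet ht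

end RandomDesign

/-! ### Least squares -/

section LeastSquares

variable {n M N : ℕ}

theorem trace_transpose_mul_self_nonneg {m n : Type*} [Fintype m] [Fintype n] (A : Matrix m n ℝ) :
    0 ≤ (Aᵀ * A).trace := by
  rw [trace_transpose_mul]
  exact Finset.sum_nonneg fun i _ => Finset.sum_nonneg fun j _ => mul_self_nonneg _

theorem eq_zero_of_trace_transpose_mul_self_le {m n : Type*} [Fintype m] [Fintype n]
    {A : Matrix m n ℝ} (h : (Aᵀ * A).trace ≤ 0) : A = 0 := by
  have h0 := le_antisymm h (trace_transpose_mul_self_nonneg A)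
  rw [← Matrix.conjTranspose_eq_transpose_of_trivial] at h0
  exact Matrix.trace_conjTranspose_mul_self_eq_zero_iff.1 h0

theorem empMse_toEuclideanLin (x : Fin n → EuclideanSpace ℝ (Fin N))
    (y : Fin n → EuclideanSpace ℝ (Fin M)) (F : Matrix (Fin N) (Fin M) ℝ) :
    empMse x y (Matrix.toEuclideanLin F) =
      (1 / (n : ℝ)) * ((rowMat y * Fᵀ - rowMat x)ᵀ * (rowMat y * Fᵀ - rowMat x)).trace := by
  rw [empMse, trace_transpose_mul]
  congr 1
  refine Finset.sum_congr rfl fun i _ => ?_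
  have h : (Matrix.toEuclideanLin F (y i) - x i).ofLp =
      (rowMat y * Fᵀ - rowMat x) i := by
    ext k
    simp [rowMat, Matrix.mul_apply, Matrix.mulVec, dotProduct, mul_comm]
  rw [norm_sq_eq_dotProduct, h]

theorem designMat_eq (R : Matrix (Fin M) (Fin M) ℝ) (y : Fin n → EuclideanSpace ℝ (Fin M)) :
    designMat R y = rowMat y * Rᵀ := by
  ext i j
  simp [designMat, rowMat, ofLp_mulEuc, Matrix.mul_apply, Matrix.mulVec, dotProduct, mul_comm]

/-- A solution of the normal equations is the least squares estimator if the data vectors span. -/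
theorem isLeastSquaresEstimator_of_normal_equations (hn : n ≠ 0)
    {x : Fin n → EuclideanSpace ℝ (Fin N)} {y : Fin n → EuclideanSpace ℝ (Fin M)}
    {F : Matrix (Fin N) (Fin M) ℝ}
    (hF : (rowMat y)ᵀ * (rowMat y * Fᵀ - rowMat x) = 0)
    (hy : ∀ K : Matrix (Fin M) (Fin N) ℝ, rowMat y * K = 0 → K = 0) :
    IsLeastSquaresEstimator x y (Matrix.toEuclideanLin F) := by
  have hn' : (0 : ℝ) < 1 / n := by positivity
  have key : ∀ G : Matrix (Fin N) (Fin M) ℝ, empMse x y (Matrix.toEuclideanLin G) =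
      empMse x y (Matrix.toEuclideanLin F) + (1 / (n : ℝ)) *
        ((rowMat y * (G - F)ᵀ)ᵀ * (rowMat y * (G - F)ᵀ)).trace := by
    intro G
    rw [empMse_toEuclideanLin, empMse_toEuclideanLin, ← mul_add]
    congr 1
    set r := rowMat y * Fᵀ - rowMat x with hr
    have hd : rowMat y * Gᵀ - rowMat x = rowMat y * (G - F)ᵀ + r := by
      rw [hr, Matrix.transpose_sub, Matrix.mul_sub]
      abel
    have h1 : (rowMat y * (G - F)ᵀ)ᵀ * r = 0 := by
      rw [Matrix.transpose_mul, Matrix.mul_assoc, hF, Matrix.mul_zero]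
    have h2 : rᵀ * (rowMat y * (G - F)ᵀ) = 0 := by
      have := congrArg Matrix.transpose h1
      rwa [Matrix.transpose_mul, Matrix.transpose_transpose, Matrix.transpose_zero] at this
    rw [hd, Matrix.transpose_add, Matrix.add_mul, Matrix.mul_add, Matrix.mul_add, h1, h2]
    simp [add_comm]
  refine ⟨fun g => ?_, fun g hg => ?_⟩
  · obtain ⟨G, rfl⟩ := Matrix.toEuclideanLin.surjective g
    rw [key G]
    have := mul_nonneg hn'.le (trace_transpose_mul_self_nonneg (rowMat y * (G - F)ᵀ))
    linarith
  · obtain ⟨G, rfl⟩ := Matrix.toEuclideanLin.surjective g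
    have h := hg (Matrix.toEuclideanLin F)
    rw [key G] at h
    have h0 : ((rowMat y * (G - F)ᵀ)ᵀ * (rowMat y * (G - F)ᵀ)).trace ≤ 0 :=
      nonpos_of_mul_nonpos_right (by linarith) hn'
    have h1 := hy _ (eq_zero_of_trace_transpose_mul_self_le h0)
    rw [← sub_eq_zero.1 (Matrix.transpose_eq_zero.1 h1)]

/-- A lower bound for `‖W v‖` on unit vectors, extended by homogeneity. -/
theorem sq_mul_norm_sq_le {m n : ℕ} {W : Matrix (Fin n) (Fin m) ℝ} {s : ℝ} (hs : 0 ≤ s)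
    (hW : ∀ v : EuclideanSpace ℝ (Fin m), ‖v‖ = 1 → s ≤ ‖mulEuc W v‖)
    (v : EuclideanSpace ℝ (Fin m)) : s ^ 2 * ‖v‖ ^ 2 ≤ ‖mulEuc W v‖ ^ 2 := by
  rcases eq_or_ne v 0 with rfl | hv
  · simp
  have hv' : 0 < ‖v‖ := norm_pos_iff.2 hv
  have h := hW (‖v‖⁻¹ • v) (norm_smul_inv_norm hv)
  have e : mulEuc W (‖v‖⁻¹ • v) = ‖v‖⁻¹ • mulEuc W v := by simp [mulEuc]
  rw [e, norm_smul, norm_inv, norm_norm, inv_mul_eq_div, le_div_iff₀ hv'] at h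
  rw [← mul_pow]
  exact pow_le_pow_left₀ (by positivity) h 2

/-- If the smallest singular value of the whitened design matrix is at least `s > 0`, the least
squares estimator exists, and its excess error, weighted by the covariance matrix `V` of the data,
is at most `s⁻²` times the energy of the projected noise. -/
theorem exists_leastSquaresEstimator [NeZero M] {V : Matrix (Fin M) (Fin M) ℝ} (hV : V.PosDef)
    (L : Matrix (Fin N) (Fin M) ℝ) {x e : Fin n → EuclideanSpace ℝ (Fin N)}
    {y : Fin n → EuclideanSpace ℝ (Fin M)} (hxy : ∀ i, x i = mulEuc L (y i) + e i) {s : ℝ}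
    (hs : 0 < s) (hsing : ∀ v : EuclideanSpace ℝ (Fin M), ‖v‖ = 1 →
      s ≤ ‖mulEuc (designMat (invSqrt V) y) v‖) :
    ((designMat (invSqrt V) y)ᵀ * designMat (invSqrt V) y).det ≠ 0 ∧
    ∃ F : Matrix (Fin N) (Fin M) ℝ, IsLeastSquaresEstimator x y (Matrix.toEuclideanLin F) ∧
      ((F - L) * V * (F - L)ᵀ).trace * s ^ 2 ≤
        projNoise (designMat (invSqrt V) y) (rowMat e) := by
  set R := invSqrt V with hR
  set W := designMat R y with hWdef
  have hRV : R * V * R = 1 := invSqrt_mul_mul_invSqrt hV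
  have hRt : Rᵀ = R := transpose_invSqrt V
  have hW : W = rowMat y * R := by rw [hWdef, designMat_eq, hRt]
  have hRR : R * (V * R) = 1 := by rw [← Matrix.mul_assoc, hRV]
  have hY : rowMat y = W * (V * R) := by rw [hW, Matrix.mul_assoc, hRR, Matrix.mul_one]
  set S := Wᵀ * W with hS
  have hSdet : S.det ≠ 0 := by
    intro h0
    obtain ⟨v, hv, hv0⟩ := Matrix.exists_mulVec_eq_zero_iff.2 h0
    have h1 := sq_mul_norm_sq_le hs.le hsing (WithLp.toLp 2 v)
    have h2 : ‖mulEuc W (WithLp.toLp 2 v)‖ ^ 2 = 0 := by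
      rw [norm_sq_eq_dotProduct, ofLp_mulEuc]
      change W *ᵥ v ⬝ᵥ W *ᵥ v = 0
      rw [Matrix.dotProduct_mulVec, ← Matrix.mulVec_transpose, Matrix.mulVec_mulVec, ← hS, hv0,
        zero_dotProduct]
    have h3 : 0 < ‖WithLp.toLp 2 v‖ := norm_pos_iff.2 fun h => hv (by simpa using h)
    have : 0 < s ^ 2 * ‖WithLp.toLp 2 v‖ ^ 2 := by positivity
    linarith
  have hSu : IsUnit S.det := isUnit_iff_ne_zero.2 hSdet
  have hSt : Sᵀ = S := by rw [hS, Matrix.transpose_mul, Matrix.transpose_transpose]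
  have hn : n ≠ 0 := by
    rintro rfl
    apply hSdet
    have : S = 0 := by
      ext i j
      simp [hS]
    rw [this, Matrix.det_zero]
  set E := rowMat e with hE
  set H := Eᵀ * W * S⁻¹ with hH
  have hHt : Hᵀ = S⁻¹ * (Wᵀ * E) := by
    rw [hH, Matrix.transpose_mul, Matrix.transpose_mul, Matrix.transpose_nonsing_inv, hSt,
      Matrix.transpose_transpose]
  have hx : rowMat x = rowMat y * Lᵀ + E := by
    ext i k
    simp [hE, rowMat, hxy, ofLp_mulEuc, Matrix.mul_apply, Matrix.mulVec, dotProduct, mul_comm]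
  refine ⟨hSdet, L + H * R, isLeastSquaresEstimator_of_normal_equations hn ?_ ?_, ?_⟩
  · have h1 : rowMat y * (L + H * R)ᵀ - rowMat x = W * Hᵀ - E := by
      rw [hx, Matrix.transpose_add, Matrix.transpose_mul, hRt, Matrix.mul_add, ← Matrix.mul_assoc,
        ← hW]
      abel
    have h2 : Wᵀ * (W * Hᵀ - E) = 0 := by
      rw [Matrix.mul_sub, ← Matrix.mul_assoc, ← hS, hHt, ← Matrix.mul_assoc S,
        Matrix.mul_nonsing_inv _ hSu, Matrix.one_mul, sub_self]
    rw [h1, hY, Matrix.transpose_mul, Matrix.mul_assoc, h2, Matrix.mul_zero]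
  · intro K hK
    have h1 : S * ((V * R) * K) = 0 := by
      rw [hS, Matrix.mul_assoc, ← Matrix.mul_assoc W, ← hY, hK, Matrix.mul_zero]
    have h2 : (V * R) * K = 0 := by
      rw [← Matrix.one_mul ((V * R) * K), ← Matrix.nonsing_inv_mul _ hSu, Matrix.mul_assoc, h1,
        Matrix.mul_zero]
    rw [← Matrix.one_mul K, ← hRR, Matrix.mul_assoc, h2, Matrix.mul_zero]
  · have h1 : (L + H * R - L) * V * (L + H * R - L)ᵀ = H * Hᵀ := by
      rw [add_sub_cancel_left, Matrix.transpose_mul, hRt]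
      calc _ = H * (R * V * R) * Hᵀ := by simp only [Matrix.mul_assoc]
        _ = _ := by rw [hRV, Matrix.mul_one]
    have h2 : projNoise W E = ((W * Hᵀ)ᵀ * (W * Hᵀ)).trace := by
      rw [projNoise, Matrix.transpose_mul, Matrix.transpose_transpose]
      congr 1
      calc _ = H * (Wᵀ * E) := by simp only [hH, ← hS, Matrix.mul_assoc]
        _ = H * (S * (S⁻¹ * (Wᵀ * E))) := by
            rw [← Matrix.mul_assoc S, Matrix.mul_nonsing_inv _ hSu, Matrix.one_mul]
        _ = _ := by rw [← hHt, hS]; simp only [Matrix.mul_assoc]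
    have h3 : ((W * Hᵀ)ᵀ * (W * Hᵀ)).trace =
        ∑ k, ‖mulEuc W (WithLp.toLp 2 (H k))‖ ^ 2 := by
      have hc := trace_transpose_mul (W * Hᵀ)ᵀ (W * Hᵀ)ᵀ
      rw [Matrix.transpose_transpose, Matrix.trace_mul_comm] at hc
      rw [hc]
      refine Finset.sum_congr rfl fun k _ => ?_
      have : (W * Hᵀ)ᵀ k = W *ᵥ H k := by
        ext i
        simp [Matrix.mul_apply, Matrix.mulVec, dotProduct]
      rw [this, norm_sq_eq_dotProduct, ofLp_mulEuc]
    have h4 : (H * Hᵀ).trace = ∑ k, ‖WithLp.toLp 2 (H k)‖ ^ 2 := by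
      rw [Matrix.trace_mul_comm, trace_transpose_mul]
      simp only [norm_sq_eq_dotProduct]
    rw [h1, h2, h3, h4, Finset.sum_mul]
    refine Finset.sum_le_sum fun k _ => ?_
    rw [mul_comm]
    exact sq_mul_norm_sq_le hs.le hsing _

end LeastSquares

/-! ### Covariance matrices and the LMMSE estimator -/

section Covariance

variable {Ω : Type*} [MeasurableSpace Ω] {P : Measure Ω} {m n : ℕ}

theorem memLp_apply {V : Ω → EuclideanSpace ℝ (Fin n)} (hV : MemLp V 2 P) (i : Fin n) :
    MemLp (fun ω => V ω i) 2 P :=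
  (EuclideanSpace.proj i : EuclideanSpace ℝ (Fin n) →L[ℝ] ℝ).comp_memLp' hV

theorem memLp_mulEuc (B : Matrix (Fin m) (Fin n) ℝ) {V : Ω → EuclideanSpace ℝ (Fin n)}
    (hV : MemLp V 2 P) : MemLp (fun ω => mulEuc B (V ω)) 2 P :=
  (LinearMap.toContinuousLinearMap (Matrix.toEuclideanLin B)).comp_memLp' hV

theorem measurable_mulEuc (B : Matrix (Fin m) (Fin n) ℝ) : Measurable (mulEuc B) :=
  (LinearMap.toContinuousLinearMap (Matrix.toEuclideanLin B)).measurable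

theorem integral_mulEuc (B : Matrix (Fin m) (Fin n) ℝ) {V : Ω → EuclideanSpace ℝ (Fin n)}
    (hV : Integrable V P) : ∫ ω, mulEuc B (V ω) ∂P = mulEuc B (∫ ω, V ω ∂P) :=
  (LinearMap.toContinuousLinearMap (Matrix.toEuclideanLin B)).integral_comp_comm hV

theorem covMat_transpose (V : Ω → EuclideanSpace ℝ (Fin n)) : (covMat P V)ᵀ = covMat P V := by
  ext i j
  exact covariance_comm _ _

variable [IsProbabilityMeasure P]

theorem covMat_mulEuc (B : Matrix (Fin m) (Fin n) ℝ) {V : Ω → EuclideanSpace ℝ (Fin n)}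
    (hV : MemLp V 2 P) : covMat P (fun ω => mulEuc B (V ω)) = B * covMat P V * Bᵀ := by
  ext i j
  simp only [covMat, Matrix.of_apply, ofLp_mulEuc, Matrix.mulVec, dotProduct]
  rw [covariance_fun_sum_fun_sum (fun k => (memLp_apply hV k).const_mul _)
    (fun k => (memLp_apply hV k).const_mul _)]
  simp only [covariance_const_mul_left, covariance_const_mul_right, Matrix.mul_apply,
    Matrix.of_apply, Matrix.transpose_apply, Finset.sum_mul]
  rw [Finset.sum_comm]
  refine Finset.sum_congr rfl fun k _ => Finset.sum_congr rfl fun l _ => ?_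
  ring

theorem covMat_add_of_indepFun {U V : Ω → EuclideanSpace ℝ (Fin n)} (hU : MemLp U 2 P)
    (hV : MemLp V 2 P) (h : IndepFun U V P) :
    covMat P (fun ω => U ω + V ω) = covMat P U + covMat P V := by
  have hz : ∀ i j, covariance (fun ω => U ω i) (fun ω => V ω j) P = 0 := fun i j =>
    (h.comp (φ := fun u : EuclideanSpace ℝ (Fin n) => u i)
      (ψ := fun u : EuclideanSpace ℝ (Fin n) => u j) (by fun_prop) (by fun_prop)).covariance_eq_zero
      (memLp_apply hU i) (memLp_apply hV j)
  ext i j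
  simp only [covMat, Matrix.of_apply, Matrix.add_apply, PiLp.add_apply]
  have hU' := fun i => memLp_apply hU i
  have hV' := fun i => memLp_apply hV i
  change covariance ((fun ω => U ω i) + fun ω => V ω i) ((fun ω => U ω j) + fun ω => V ω j) P = _
  rw [covariance_add_left (hU' i) (hV' i) ((hU' j).add (hV' j)),
    covariance_add_right (hU' i) (hU' j) (hV' j), covariance_add_right (hV' i) (hU' j) (hV' j),
    hz i j, covariance_comm (fun ω => V ω i), hz j i]
  ring

theorem posSemidef_covMat {V : Ω → EuclideanSpace ℝ (Fin n)} (hV : MemLp V 2 P) :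
    (covMat P V).PosSemidef := by
  refine Matrix.PosSemidef.of_dotProduct_mulVec_nonneg ?_ fun x => ?_
  · rw [Matrix.IsHermitian, Matrix.conjTranspose_eq_transpose_of_trivial, covMat_transpose]
  · have h := covMat_mulEuc (Matrix.of fun (_ : Fin 1) j => x j) hV
    have h0 := congrFun (congrFun h 0) 0
    rw [covMat, Matrix.of_apply, covariance_self
      (memLp_apply (memLp_mulEuc _ hV) 0).aestronglyMeasurable.aemeasurable] at h0
    have h1 := variance_nonneg (fun ω => mulEuc (Matrix.of fun (_ : Fin 1) j => x j) (V ω) 0) P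
    rw [h0] at h1
    refine h1.trans_eq ?_
    rw [Matrix.mul_assoc]
    simp only [Matrix.mul_apply, dotProduct, Matrix.mulVec, Matrix.of_apply,
      Matrix.transpose_apply, star_trivial]

theorem posDef_covMat {V : Ω → EuclideanSpace ℝ (Fin n)} (hV : MemLp V 2 P)
    (hu : IsUnit (covMat P V)) : (covMat P V).PosDef :=
  (posSemidef_covMat hV).posDef_iff_isUnit.2 hu

theorem integral_norm_sq_eq_trace_covMat {V : Ω → EuclideanSpace ℝ (Fin n)} (hV : MemLp V 2 P)
    (h0 : ∫ ω, V ω ∂P = 0) : ∫ ω, ‖V ω‖ ^ 2 ∂P = (covMat P V).trace := by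
  have h0' : ∀ i, ∫ ω, V ω i ∂P = 0 := fun i => by
    have := (EuclideanSpace.proj i : EuclideanSpace ℝ (Fin n) →L[ℝ] ℝ).integral_comp_comm
      (hV.integrable one_le_two)
    rw [h0] at this
    simpa using this
  simp only [EuclideanSpace.norm_sq_eq, Real.norm_eq_abs, sq_abs]
  rw [integral_finsetSum _ fun i _ => (memLp_apply hV i).integrable_sq]
  refine Finset.sum_congr rfl fun i _ => ?_
  simp only [covMat, Matrix.diag_apply, Matrix.of_apply, covariance, h0', sub_zero]
  simp only [sq]

end Covariance

section LMMSE

variable {M N : ℕ} (A : Matrix (Fin M) (Fin N) ℝ) {CXX : Matrix (Fin N) (Fin N) ℝ}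
  {CZZ : Matrix (Fin M) (Fin M) ℝ}

theorem posDef_precision (hX : CXX.PosDef) (hZ : CZZ.PosDef) :
    (Aᵀ * CZZ⁻¹ * A + CXX⁻¹).PosDef := by
  refine Matrix.PosDef.posSemidef_add ?_ hX.inv
  have := hZ.inv.posSemidef.conjTranspose_mul_mul_same A
  rwa [Matrix.conjTranspose_eq_transpose_of_trivial] at this

theorem posDef_dataCov (hX : CXX.PosDef) (hZ : CZZ.PosDef) :
    (A * CXX * Aᵀ + CZZ).PosDef := by
  refine Matrix.PosDef.posSemidef_add ?_ hZ
  have := hX.posSemidef.mul_mul_conjTranspose_same A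
  rwa [Matrix.conjTranspose_eq_transpose_of_trivial] at this

theorem isUnit_det_of_posDef {n : ℕ} {C : Matrix (Fin n) (Fin n) ℝ} (hC : C.PosDef) :
    IsUnit C.det := (Matrix.isUnit_iff_isUnit_det C).1 hC.isUnit

/-- The estimation error of the LMMSE estimator is uncorrelated with the data. -/
theorem lmmseMat_mul_dataCov (hX : CXX.PosDef) (hZ : CZZ.PosDef) :
    lmmseMat A CXX CZZ * (A * CXX * Aᵀ + CZZ) = CXX * Aᵀ := by
  have hQ := isUnit_det_of_posDef (posDef_precision A hX hZ)
  have hXu := isUnit_det_of_posDef hX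
  have hZu := isUnit_det_of_posDef hZ
  have h : Aᵀ * CZZ⁻¹ * (A * CXX * Aᵀ + CZZ) = (Aᵀ * CZZ⁻¹ * A + CXX⁻¹) * (CXX * Aᵀ) := by
    rw [Matrix.mul_add, Matrix.add_mul, Matrix.mul_assoc Aᵀ CZZ⁻¹ CZZ,
      Matrix.nonsing_inv_mul _ hZu, Matrix.mul_one, ← Matrix.mul_assoc CXX⁻¹,
      Matrix.nonsing_inv_mul _ hXu, Matrix.one_mul]
    simp only [Matrix.mul_assoc]
  rw [lmmseMat, Matrix.mul_assoc, Matrix.mul_assoc, ← Matrix.mul_assoc Aᵀ, h, ← Matrix.mul_assoc,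
    Matrix.nonsing_inv_mul _ hQ, Matrix.one_mul]

theorem lmmseMat_eq (hX : CXX.PosDef) (hZ : CZZ.PosDef) :
    lmmseMat A CXX CZZ = CXX * Aᵀ * (A * CXX * Aᵀ + CZZ)⁻¹ := by
  rw [← lmmseMat_mul_dataCov A hX hZ, Matrix.mul_assoc,
    Matrix.mul_nonsing_inv _ (isUnit_det_of_posDef (posDef_dataCov A hX hZ)), Matrix.mul_one]

theorem posDef_errCov (hX : CXX.PosDef) (hZ : CZZ.PosDef) : (errCov A CXX CZZ).PosDef := by
  have hQ := isUnit_det_of_posDef (posDef_precision A hX hZ)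
  have h : (Aᵀ * CZZ⁻¹ * A + CXX⁻¹) * errCov A CXX CZZ = 1 := by
    have h1 : errCov A CXX CZZ = CXX - lmmseMat A CXX CZZ * A * CXX := by
      rw [lmmseMat_eq A hX hZ, errCov]
    rw [h1, lmmseMat, Matrix.mul_sub, Matrix.add_mul,
      Matrix.nonsing_inv_mul _ (isUnit_det_of_posDef hX)]
    simp only [← Matrix.mul_assoc]
    rw [Matrix.mul_nonsing_inv _ hQ, Matrix.one_mul]
    abel
  rw [← Matrix.inv_eq_right_inv h]
  exact (posDef_precision A hX hZ).inv

/-- Completing the square: the error covariance of a linear estimator `F` splits into the error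
covariance of the LMMSE estimator and the excess error. -/
theorem errCov_add_excess (hX : CXX.PosDef) (hZ : CZZ.PosDef) (F : Matrix (Fin N) (Fin M) ℝ) :
    (F * A - 1) * CXX * (F * A - 1)ᵀ + F * CZZ * Fᵀ = errCov A CXX CZZ +
      (F - lmmseMat A CXX CZZ) * (A * CXX * Aᵀ + CZZ) * (F - lmmseMat A CXX CZZ)ᵀ := by
  set L := lmmseMat A CXX CZZ with hL
  set V := A * CXX * Aᵀ + CZZ with hV
  have hVt : Vᵀ = V := transpose_eq_of_posDef (posDef_dataCov A hX hZ)
  have hXt := transpose_eq_of_posDef hX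
  have h1 : L * V = CXX * Aᵀ := lmmseMat_mul_dataCov A hX hZ
  have h2 : V * Lᵀ = A * CXX := by
    have := congrArg Matrix.transpose h1
    rwa [Matrix.transpose_mul, Matrix.transpose_mul, hVt, hXt, Matrix.transpose_transpose] at this
  have h3 : errCov A CXX CZZ = CXX - L * A * CXX := by
    rw [hL, lmmseMat_eq A hX hZ, errCov]
  have e1 : (F - L) * V * (F - L)ᵀ = F * V * Fᵀ - F * A * CXX - CXX * Aᵀ * Fᵀ + L * A * CXX := by
    rw [Matrix.transpose_sub, Matrix.sub_mul, Matrix.mul_sub, Matrix.sub_mul, Matrix.sub_mul,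
      Matrix.mul_assoc F V Lᵀ, h2, Matrix.mul_assoc L V Lᵀ, h2, h1]
    simp only [Matrix.mul_assoc]
    abel
  have e2 : (F * A - 1) * CXX * (F * A - 1)ᵀ + F * CZZ * Fᵀ =
      F * V * Fᵀ - F * A * CXX - CXX * Aᵀ * Fᵀ + CXX := by
    rw [hV, Matrix.transpose_sub, Matrix.transpose_one, Matrix.transpose_mul]
    simp only [Matrix.mul_sub, Matrix.sub_mul, Matrix.mul_add, Matrix.add_mul, Matrix.mul_one,
      Matrix.one_mul, Matrix.mul_assoc]
    abel
  rw [e1, e2, h3]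
  abel

end LMMSE

section Model

variable {Ω : Type*} [MeasurableSpace Ω] {P : Measure Ω} [IsProbabilityMeasure P] {M N : ℕ}
  {A : Matrix (Fin M) (Fin N) ℝ} {X : Ω → EuclideanSpace ℝ (Fin N)}
  {Z Y : Ω → EuclideanSpace ℝ (Fin M)}

theorem covMat_linearModel {k : ℕ} (B : Matrix (Fin k) (Fin N) ℝ) (D : Matrix (Fin k) (Fin M) ℝ)
    (hXZ : IndepFun X Z P) (hX2 : MemLp X 2 P) (hZ2 : MemLp Z 2 P) :
    covMat P (fun ω => mulEuc B (X ω) + mulEuc D (Z ω)) =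
      B * covMat P X * Bᵀ + D * covMat P Z * Dᵀ := by
  rw [covMat_add_of_indepFun (memLp_mulEuc B hX2) (memLp_mulEuc D hZ2)
    (hXZ.comp (measurable_mulEuc B) (measurable_mulEuc D)), covMat_mulEuc B hX2,
    covMat_mulEuc D hZ2]

theorem mse_eq (hXZ : IndepFun X Z P) (hX2 : MemLp X 2 P) (hZ2 : MemLp Z 2 P)
    (hX0 : ∫ ω, X ω ∂P = 0) (hZ0 : ∫ ω, Z ω ∂P = 0) (hCXX : (covMat P X).PosDef)
    (hCZZ : (covMat P Z).PosDef) (hY : Y = fun ω => mulEuc A (X ω) + Z ω)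
    (F : Matrix (Fin N) (Fin M) ℝ) :
    mse P X Y (Matrix.toEuclideanLin F) = (errCov A (covMat P X) (covMat P Z)).trace +
      ((F - lmmseMat A (covMat P X) (covMat P Z)) * (A * covMat P X * Aᵀ + covMat P Z) *
        (F - lmmseMat A (covMat P X) (covMat P Z))ᵀ).trace := by
  rw [← Matrix.trace_add, ← errCov_add_excess A hCXX hCZZ F,
    ← covMat_linearModel (F * A - 1) F hXZ hX2 hZ2, mse]
  have h : ∀ ω, Matrix.toEuclideanLin F (Y ω) - X ω =
      mulEuc (F * A - 1) (X ω) + mulEuc F (Z ω) := by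
    intro ω
    apply WithLp.ofLp_injective 2
    rw [hY]
    simp only [WithLp.ofLp_sub, WithLp.ofLp_add, ofLp_mulEuc, Matrix.ofLp_toLpLin,
      Matrix.toLin'_apply, Matrix.sub_mulVec, Matrix.one_mulVec, Matrix.mulVec_add, Matrix.mulVec_mulVec]
    abel
  simp_rw [h]
  have hI1 := (memLp_mulEuc (F * A - 1) hX2).integrable one_le_two
  have hI2 := (memLp_mulEuc F hZ2).integrable one_le_two
  refine integral_norm_sq_eq_trace_covMat
    ((memLp_mulEuc (F * A - 1) hX2).add (memLp_mulEuc F hZ2)) ?_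
  rw [integral_add hI1 hI2, integral_mulEuc _ (hX2.integrable one_le_two),
    integral_mulEuc _ (hZ2.integrable one_le_two), hX0, hZ0]
  simp [mulEuc]

/-- If `L Y` is the conditional expectation of `X` given `Y`, the conditional laws of the error
`X - L Y` are centred. -/
theorem ae_integral_condDistrib_eq_zero (hX : Measurable X) (hY : Measurable Y)
    (hX1 : Integrable X P) (hY1 : Integrable Y P) {L : Matrix (Fin N) (Fin M) ℝ}
    (h : P[X | MeasurableSpace.comap Y inferInstance] =ᵐ[P] fun ω => mulEuc L (Y ω)) :
    ∀ᵐ y ∂(P.map Y), ∫ e, e ∂(condDistrib (fun ω => X ω - mulEuc L (Y ω)) Y P y) = 0 := by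
  have hLY : Integrable (fun ω => mulEuc L (Y ω)) P :=
    (LinearMap.toContinuousLinearMap (Matrix.toEuclideanLin L)).integrable_comp hY1
  have hE : Integrable (fun ω => X ω - mulEuc L (Y ω)) P := hX1.sub hLY
  have hEm : Measurable fun ω => X ω - mulEuc L (Y ω) := hX.sub ((measurable_mulEuc L).comp hY)
  have h1 := condExp_ae_eq_integral_condDistrib' hY hE
  have h2 : P[fun ω => X ω - mulEuc L (Y ω) | MeasurableSpace.comap Y inferInstance] =ᵐ[P] 0 := by
    have hs := condExp_sub hX1 hLY (MeasurableSpace.comap Y inferInstance)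
    have hc : P[fun ω => mulEuc L (Y ω) | MeasurableSpace.comap Y inferInstance] =
        fun ω => mulEuc L (Y ω) :=
      condExp_of_stronglyMeasurable hY.comap_le
        ((measurable_mulEuc L).comp (comap_measurable Y)).stronglyMeasurable hLY
    filter_upwards [hs, h] with ω hω hω'
    change (P[X - fun ω => mulEuc L (Y ω) | MeasurableSpace.comap Y inferInstance]) ω = 0
    rw [hω, Pi.sub_apply, hω', hc, sub_self]
  have hm : Measurable fun y => ∫ e, e ∂(condDistrib (fun ω => X ω - mulEuc L (Y ω)) Y P y) :=
    (StronglyMeasurable.integral_kernel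
      (κ := condDistrib (fun ω => X ω - mulEuc L (Y ω)) Y P) stronglyMeasurable_id).measurable
  rw [ae_map_iff hY.aemeasurable (measurableSet_eq_fun hm measurable_const)]
  filter_upwards [h1, h2] with ω hω hω'
  rw [← hω, hω']
  rfl

end Model

/-! ### Sums of squares of sub-Gaussian variables -/

section SubExponential

variable {Ω : Type*} [MeasurableSpace Ω] {P : Measure Ω} [IsProbabilityMeasure P]

theorem lintegral_exp_mul_sq_le {ξ : Ω → ℝ} (hξ : Measurable ξ) {σ : ℝ≥0}
    (hs : HasSubgaussianMGF ξ σ P) {θ : ℝ} (hθ : 0 ≤ θ) (hθσ : 2 * θ * σ < 1) :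
    ∫⁻ ω, ENNReal.ofReal (Real.exp (θ * ξ ω ^ 2)) ∂P ≤
      ENNReal.ofReal (Real.exp (θ * σ + θ ^ 2 * σ ^ 2 / (1 - 2 * θ * σ))) := by
  have h := lintegral_exp_sum_sq_le (Q := P) (ξ := fun ω (_ : Unit) => ξ ω)
    (measurable_pi_iff.2 fun _ => hξ) (lam := fun _ => (σ : ℝ)) (fun _ => σ.2) (fun z => ?_)
    (b := σ) (fun _ => le_rfl) hθ hθσ
  · simpa using h
  · have h1 := hs.mgf_le (z ())
    rw [mgf] at h1
    simp only [Finset.univ_unique, PUnit.default_eq_unit, Finset.sum_singleton]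
    rw [← ofReal_integral_eq_lintegral_ofReal (hs.integrable_exp_mul _)
      (ae_of_all _ fun _ => (Real.exp_pos _).le)]
    exact ENNReal.ofReal_le_ofReal h1

theorem integrable_exp_mul_sq {ξ : Ω → ℝ} (hξ : Measurable ξ) {σ : ℝ≥0}
    (hs : HasSubgaussianMGF ξ σ P) {θ : ℝ} (hθ : 0 ≤ θ) (hθσ : 2 * θ * σ < 1) :
    Integrable (fun ω => Real.exp (θ * ξ ω ^ 2)) P := by
  refine ⟨by fun_prop, ?_⟩
  rw [hasFiniteIntegral_iff_ofReal (ae_of_all _ fun _ => (Real.exp_pos _).le)]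
  exact (lintegral_exp_mul_sq_le hξ hs hθ hθσ).trans_lt ENNReal.ofReal_lt_top

theorem integral_exp_mul_sq_le {ξ : Ω → ℝ} (hξ : Measurable ξ) {σ : ℝ≥0}
    (hs : HasSubgaussianMGF ξ σ P) {θ : ℝ} (hθ : 0 ≤ θ) (hθσ : 2 * θ * σ < 1) :
    ∫ ω, Real.exp (θ * ξ ω ^ 2) ∂P ≤
      Real.exp (θ * σ + θ ^ 2 * σ ^ 2 / (1 - 2 * θ * σ)) := by
  rw [integral_eq_lintegral_of_nonneg_ae (ae_of_all _ fun _ => (Real.exp_pos _).le) (by fun_prop)]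
  exact ENNReal.toReal_le_of_le_ofReal (Real.exp_pos _).le (lintegral_exp_mul_sq_le hξ hs hθ hθσ)

/-- The variance of a centred sub-Gaussian random variable is at most its variance proxy. -/
theorem one_le_of_hasSubgaussianMGF {ξ : Ω → ℝ} (hξ : Measurable ξ) {σ : ℝ≥0}
    (hs : HasSubgaussianMGF ξ σ P) (h1 : ∫ ω, ξ ω ^ 2 ∂P = 1) : 1 ≤ (σ : ℝ) := by
  by_contra! hlt
  set θ : ℝ := (1 - σ) / 4 with hθ
  have hσ0 : 0 ≤ (σ : ℝ) := σ.2
  have hθ0 : 0 < θ := by rw [hθ]; linarith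
  have hθσ : θ * σ ≤ 1 / 4 := by
    have : θ ≤ 1 / 4 := by rw [hθ]; linarith
    nlinarith
  have hθσ' : 2 * θ * σ < 1 := by linarith
  have hle := integral_exp_mul_sq_le hξ hs hθ0.le hθσ'
  have hint : Integrable (fun ω => ξ ω ^ 2) P := (hs.memLp 2).integrable_sq
  have hint1 : Integrable (fun ω => ξ ω ^ 2 - 1) P := hint.sub (integrable_const 1)
  have hge : Real.exp θ ≤ ∫ ω, Real.exp (θ * ξ ω ^ 2) ∂P := by
    -- Jensen's inequality, through the tangent line of the exponential
    have hlin : ∫ ω, Real.exp θ * (θ * (ξ ω ^ 2 - 1) + 1) ∂P = Real.exp θ := by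
      rw [integral_const_mul, integral_add (hint1.const_mul θ)
        (integrable_const 1), integral_const_mul, integral_sub hint (integrable_const 1), h1]
      simp
    rw [← hlin]
    refine integral_mono (((hint1.const_mul θ).add
      (integrable_const 1)).const_mul _) (integrable_exp_mul_sq hξ hs hθ0.le hθσ') fun ω => ?_
    have := Real.add_one_le_exp (θ * (ξ ω ^ 2 - 1))
    calc Real.exp θ * (θ * (ξ ω ^ 2 - 1) + 1) ≤ Real.exp θ * Real.exp (θ * (ξ ω ^ 2 - 1)) := by
          gcongr
      _ = Real.exp (θ * ξ ω ^ 2) := by rw [← Real.exp_add]; congr 1; ring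
  have h2 := Real.exp_le_exp.1 (hge.trans hle)
  have h3 : θ ^ 2 * σ ^ 2 / (1 - 2 * θ * σ) ≤ 2 * θ ^ 2 := by
    rw [div_le_iff₀ (by linarith)]
    have : (σ : ℝ) ^ 2 ≤ 1 := by nlinarith
    nlinarith [sq_nonneg θ]
  have h4 : (σ : ℝ) = 1 - 4 * θ := by rw [hθ]; ring
  nlinarith

theorem exp_le_quadratic (x : ℝ) : Real.exp x ≤ 1 + x + x ^ 2 * Real.exp |x| := by
  have h := Complex.norm_exp_sub_sum_le_norm_mul_exp x 2
  have e : Complex.exp x - ∑ m ∈ Finset.range 2, (x : ℂ) ^ m / (m.factorial : ℂ) =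
      ((Real.exp x - (1 + x) : ℝ) : ℂ) := by
    simp [Finset.sum_range_succ]
  rw [e, Complex.norm_real, Complex.norm_real, Real.norm_eq_abs, Real.norm_eq_abs, sq_abs] at h
  linarith [(abs_le.1 h).2]

/-- The centred square of a sub-Gaussian random variable is sub-exponential. -/
theorem lintegral_exp_mul_sq_sub_one_le {ξ : Ω → ℝ} (hξ : Measurable ξ) {σ : ℝ≥0}
    (hs : HasSubgaussianMGF ξ σ P) (h1 : ∫ ω, ξ ω ^ 2 ∂P = 1) {θ : ℝ}
    (hθ : |θ| ≤ 1 / (8 * σ)) :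
    ∫⁻ ω, ENNReal.ofReal (Real.exp (θ * (ξ ω ^ 2 - 1))) ∂P ≤
      ENNReal.ofReal (Real.exp (256 * σ ^ 2 * θ ^ 2)) := by
  have hσ : 1 ≤ (σ : ℝ) := one_le_of_hasSubgaussianMGF hξ hs h1
  have hσ0 : 0 < (σ : ℝ) := by linarith
  set a : ℝ := 1 / (8 * σ) with ha
  have ha0 : 0 < a := by positivity
  have haσ : a * σ = 1 / 8 := by rw [ha]; field_simp
  have ha8 : a ≤ 1 / 8 := by nlinarith
  have hint : Integrable (fun ω => ξ ω ^ 2) P := (hs.memLp 2).integrable_sq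
  have hint1 : Integrable (fun ω => ξ ω ^ 2 - 1) P := hint.sub (integrable_const 1)
  have h2a : 2 * (2 * a) * σ < 1 := by linarith
  have hI := integrable_exp_mul_sq hξ hs (by positivity : 0 ≤ 2 * a) h2a
  have hle := integral_exp_mul_sq_le hξ hs (by positivity : 0 ≤ 2 * a) h2a
  set D : ℝ := 128 * σ ^ 2 * θ ^ 2 * Real.exp (1 / 4) with hD
  have hpt : ∀ ω, Real.exp (θ * (ξ ω ^ 2 - 1)) ≤
      1 + θ * (ξ ω ^ 2 - 1) + D * Real.exp (2 * a * ξ ω ^ 2) := by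
    intro ω
    refine (exp_le_quadratic _).trans ?_
    gcongr 1 + θ * (ξ ω ^ 2 - 1) + ?_
    set s := |ξ ω ^ 2 - 1| with hsdef
    have hs0 : 0 ≤ s := abs_nonneg _
    have hx : |θ * (ξ ω ^ 2 - 1)| ≤ a * s := by rw [abs_mul]; gcongr
    have hx2 : (θ * (ξ ω ^ 2 - 1)) ^ 2 = θ ^ 2 * s ^ 2 := by rw [hsdef, sq_abs]; ring
    have hs1 : s ≤ ξ ω ^ 2 + 1 := abs_le.2 ⟨by nlinarith [sq_nonneg (ξ ω)], by linarith⟩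
    have hs2 : s ^ 2 ≤ 128 * σ ^ 2 * Real.exp (a * s) := by
      have := Real.quadratic_le_exp_of_nonneg (mul_nonneg ha0.le hs0)
      have h3 : (a * s) ^ 2 / 2 ≤ Real.exp (a * s) := by
        have := mul_nonneg ha0.le hs0
        linarith
      have h4 : s = 8 * σ * (a * s) := by
        have : 8 * σ * (a * s) = 8 * (a * σ) * s := by ring
        rw [this, haσ]
        ring
      calc s ^ 2 = 128 * σ ^ 2 * ((a * s) ^ 2 / 2) := by
            conv_lhs => rw [h4]
            ring
        _ ≤ _ := by gcongr
    calc (θ * (ξ ω ^ 2 - 1)) ^ 2 * Real.exp |θ * (ξ ω ^ 2 - 1)|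
        ≤ (θ ^ 2 * (128 * σ ^ 2 * Real.exp (a * s))) * Real.exp (a * s) := by
          rw [hx2]
          gcongr
      _ = 128 * σ ^ 2 * θ ^ 2 * Real.exp (2 * a * s) := by
          rw [show 2 * a * s = a * s + a * s by ring, Real.exp_add]
          ring
      _ ≤ 128 * σ ^ 2 * θ ^ 2 * Real.exp (1 / 4 + 2 * a * ξ ω ^ 2) := by
          gcongr
          nlinarith
      _ = _ := by rw [Real.exp_add, hD]; ring
  have hI1 : Integrable (fun ω => 1 + θ * (ξ ω ^ 2 - 1)) P :=
    (integrable_const 1).add (hint1.const_mul θ)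
  have hI2 : Integrable (fun ω => D * Real.exp (2 * a * ξ ω ^ 2)) P := hI.const_mul _
  calc ∫⁻ ω, ENNReal.ofReal (Real.exp (θ * (ξ ω ^ 2 - 1))) ∂P
      ≤ ∫⁻ ω, ENNReal.ofReal
          (1 + θ * (ξ ω ^ 2 - 1) + D * Real.exp (2 * a * ξ ω ^ 2)) ∂P :=
        lintegral_mono fun ω => ENNReal.ofReal_le_ofReal (hpt ω)
    _ = ENNReal.ofReal (∫ ω, (1 + θ * (ξ ω ^ 2 - 1) + D * Real.exp (2 * a * ξ ω ^ 2)) ∂P) :=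
        (ofReal_integral_eq_lintegral_ofReal (hI1.add hI2)
          (ae_of_all _ fun ω => (Real.exp_pos _).le.trans (hpt ω))).symm
    _ ≤ _ := by
        refine ENNReal.ofReal_le_ofReal ?_
        have hmean : ∫ ω, (1 + θ * (ξ ω ^ 2 - 1)) ∂P = 1 := by
          rw [integral_add (integrable_const 1) (hint1.const_mul θ),
            integral_const_mul, integral_sub hint (integrable_const 1), h1]
          simp
        have hexp : Real.exp (1 / 4) * ∫ ω, Real.exp (2 * a * ξ ω ^ 2) ∂P ≤ 2 := by
          have e1 : 2 * a * σ + (2 * a) ^ 2 * σ ^ 2 / (1 - 2 * (2 * a) * σ) = 3 / 8 := by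
            rw [show 2 * a * σ = 2 * (a * σ) by ring,
              show (2 * a) ^ 2 * (σ : ℝ) ^ 2 = 4 * (a * σ) ^ 2 by ring,
              show 2 * (2 * a) * σ = 4 * (a * σ) by ring, haσ]
            norm_num
          rw [e1] at hle
          calc _ ≤ Real.exp (1 / 4) * Real.exp (3 / 8) := by gcongr
            _ = Real.exp (5 / 8) := by rw [← Real.exp_add]; norm_num
            _ ≤ Real.exp (Real.log 2) := Real.exp_le_exp.2 (by linarith [Real.log_two_gt_d9])
            _ = 2 := Real.exp_log two_pos
        rw [integral_add hI1 hI2, hmean, integral_const_mul]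
        have hf : D * ∫ ω, Real.exp (2 * a * ξ ω ^ 2) ∂P ≤ 256 * σ ^ 2 * θ ^ 2 := by
          rw [hD, mul_assoc]
          calc _ ≤ 128 * (σ : ℝ) ^ 2 * θ ^ 2 * 2 := by gcongr
            _ = _ := by ring
        linarith [Real.add_one_le_exp (256 * (σ : ℝ) ^ 2 * θ ^ 2)]

/-- Bernstein's inequality for the sum of the centred squares. The exponent is
`θ = √q / (16 σ (√n + √q))`, which is of the order of `min (√(q / n)) 1 / σ`. -/
theorem measure_abs_sum_sq_sub_ge_le {n : ℕ} {ξ : Fin n → Ω → ℝ} (hξ : ∀ i, Measurable (ξ i))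
    (hind : iIndepFun ξ P) {σ : ℝ≥0} (hσ : 0 < σ) (hs : ∀ i, HasSubgaussianMGF (ξ i) σ P)
    (h1 : ∀ i, ∫ ω, ξ i ω ^ 2 ∂P = 1) {q : ℝ} (hq : 0 < q) :
    P {ω | 32 * σ * (√n * √q + q) ≤ |∑ i, ξ i ω ^ 2 - n|} ≤
      2 * ENNReal.ofReal (Real.exp (-q)) := by
  have hσ0 : (0 : ℝ) < σ := hσ
  have hr : 0 < √q := Real.sqrt_pos.2 hq
  have hn0 : 0 ≤ √(n : ℝ) := Real.sqrt_nonneg _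
  have hrq : √q ^ 2 = q := Real.sq_sqrt hq.le
  have hnn : √(n : ℝ) ^ 2 = n := Real.sq_sqrt (Nat.cast_nonneg n)
  set s := 32 * σ * (√n * √q + q) with hsdef
  set θ := √q / (16 * σ * (√n + √q)) with hθ
  have hθ0 : 0 < θ := by positivity
  have hθs : θ * s = 2 * q := by
    rw [hθ, hsdef, div_mul_eq_mul_div, div_eq_iff (by positivity)]
    linear_combination 32 * (σ : ℝ) * √n * hrq
  have hθσ : θ ≤ 1 / (8 * σ) := by
    rw [hθ, div_le_div_iff₀ (by positivity) (by positivity)]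
    nlinarith [mul_nonneg hσ0.le hn0, mul_nonneg hσ0.le hr.le]
  have hvar : n * (256 * (σ : ℝ) ^ 2 * θ ^ 2) ≤ q := by
    have h2 : θ * (16 * σ) * (√n + √q) = √q := by
      rw [hθ]
      field_simp
    calc n * (256 * (σ : ℝ) ^ 2 * θ ^ 2) = (θ * (16 * σ) * √n) ^ 2 := by
          rw [← hnn, mul_pow]
          rw [Real.sqrt_sq hn0]
          ring
      _ ≤ (θ * (16 * σ) * (√n + √q)) ^ 2 := by gcongr; linarith
      _ = q := by rw [h2, hrq]
  have hone : ∀ τ : ℝ, |τ| = θ →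
      P {ω | s * θ ≤ τ * (∑ i, ξ i ω ^ 2 - n)} ≤ ENNReal.ofReal (Real.exp (-q)) := by
    intro τ hτ
    have hsum : ∀ ω, ENNReal.ofReal (Real.exp (τ * (∑ i, ξ i ω ^ 2 - n))) =
        ∏ i, ENNReal.ofReal (Real.exp (τ * (ξ i ω ^ 2 - 1))) := by
      intro ω
      rw [← ENNReal.ofReal_prod_of_nonneg fun _ _ => (Real.exp_pos _).le, ← Real.exp_sum,
        ← Finset.mul_sum, Finset.sum_sub_distrib]
      simp
    have hmgf : ∫⁻ ω, ENNReal.ofReal (Real.exp (τ * (∑ i, ξ i ω ^ 2 - n))) ∂P ≤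
        ENNReal.ofReal (Real.exp q) := by
      simp_rw [hsum]
      rw [lintegral_prod_eq_prod_lintegral_of_indepFun Finset.univ
        (fun i ω => ENNReal.ofReal (Real.exp (τ * (ξ i ω ^ 2 - 1))))
        (hind.comp (fun _ x => ENNReal.ofReal (Real.exp (τ * (x ^ 2 - 1)))) fun _ => by fun_prop)
        (fun i => by have := hξ i; fun_prop)]
      calc _ ≤ ∏ _i : Fin n, ENNReal.ofReal (Real.exp (256 * σ ^ 2 * θ ^ 2)) := by
            refine Finset.prod_le_prod' fun i _ => ?_
            have := lintegral_exp_mul_sq_sub_one_le (hξ i) (hs i) (h1 i) (hτ.trans_le hθσ)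
            rwa [← sq_abs τ, hτ] at this
        _ = ENNReal.ofReal (Real.exp (n * (256 * σ ^ 2 * θ ^ 2))) := by
            rw [Finset.prod_const, ← ENNReal.ofReal_pow (Real.exp_pos _).le, ← Real.exp_nat_mul]
            simp
        _ ≤ _ := ENNReal.ofReal_le_ofReal (Real.exp_le_exp.2 hvar)
    have hsub : {ω | s * θ ≤ τ * (∑ i, ξ i ω ^ 2 - n)} ⊆
        {ω | ENNReal.ofReal (Real.exp (2 * q)) ≤
          ENNReal.ofReal (Real.exp (τ * (∑ i, ξ i ω ^ 2 - n)))} := fun ω hω => by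
      refine ENNReal.ofReal_le_ofReal (Real.exp_le_exp.2 ?_)
      rw [← hθs, mul_comm]
      exact hω
    refine (measure_mono hsub).trans ((meas_ge_le_lintegral_div (by fun_prop)
      (by simpa using Real.exp_pos _) ENNReal.ofReal_ne_top).trans ?_)
    refine (ENNReal.div_le_div_right hmgf _).trans ?_
    rw [← ENNReal.ofReal_div_of_pos (Real.exp_pos _), ← Real.exp_sub]
    exact ENNReal.ofReal_le_ofReal (Real.exp_le_exp.2 (by linarith))
  have hcover : {ω | s ≤ |∑ i, ξ i ω ^ 2 - n|} ⊆
      {ω | s * θ ≤ θ * (∑ i, ξ i ω ^ 2 - n)} ∪ {ω | s * θ ≤ -θ * (∑ i, ξ i ω ^ 2 - n)} := by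
    intro ω hω
    rcases le_abs.1 (show s ≤ |∑ i, ξ i ω ^ 2 - n| from hω) with h | h
    · left
      change s * θ ≤ θ * (∑ i, ξ i ω ^ 2 - n)
      nlinarith
    · right
      change s * θ ≤ -θ * (∑ i, ξ i ω ^ 2 - n)
      nlinarith
  refine (measure_mono hcover).trans ((measure_union_le _ _).trans ?_)
  rw [two_mul]
  exact add_le_add (hone θ (abs_of_pos hθ0)) (hone (-θ) (by rw [abs_neg, abs_of_pos hθ0]))

end SubExponential

/-! ### Singular values of matrices with sub-Gaussian rows -/

section Net

/-- The unit sphere of `ℝᵐ` has a `1/2`-net of at most `5 ^ m` points: a maximal separated set. -/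
theorem exists_sphere_net (m : ℕ) : ∃ T : Finset (EuclideanSpace ℝ (Fin m)),
    T.card ≤ 5 ^ m ∧ (∀ u ∈ T, ‖u‖ = 1) ∧
      ∀ v : EuclideanSpace ℝ (Fin m), ‖v‖ = 1 → ∃ u ∈ T, ‖v - u‖ < 1 / 2 := by
  classical
  let p : ℕ → Prop := fun k => ∃ T : Finset (EuclideanSpace ℝ (Fin m)), T.card = k ∧
    (∀ u ∈ T, ‖u‖ = 1) ∧ ∀ u ∈ T, ∀ v ∈ T, u ≠ v → 1 / 2 ≤ ‖u - v‖
  have hbound : ∀ k, p k → k ≤ 5 ^ m := by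
    rintro k ⟨T, rfl, h1, h2⟩
    have hinj : Function.Injective fun u : EuclideanSpace ℝ (Fin m) => (2 : ℝ) • u :=
      smul_right_injective _ two_ne_zero
    have := Besicovitch.card_le_of_separated (T.image fun u => (2 : ℝ) • u) ?_ ?_
    · rwa [Finset.card_image_of_injective _ hinj, finrank_euclideanSpace_fin] at this
    · intro c hc
      obtain ⟨u, hu, rfl⟩ := Finset.mem_image.1 hc
      rw [norm_smul, h1 u hu]
      norm_num
    · intro c hc d hd hcd
      obtain ⟨u, hu, rfl⟩ := Finset.mem_image.1 hc
      obtain ⟨v, hv, rfl⟩ := Finset.mem_image.1 hd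
      have := h2 u hu v hv fun h => hcd (by rw [h])
      rw [← smul_sub, norm_smul, Real.norm_eq_abs, abs_two]
      linarith
  have hp0 : p 0 := ⟨∅, by simp⟩
  obtain ⟨T, hcard, h1, h2⟩ := Nat.findGreatest_spec (P := p) (Nat.zero_le (5 ^ m)) hp0
  refine ⟨T, hbound _ ⟨T, rfl, h1, h2⟩, h1, fun v hv => ?_⟩
  by_contra! hfar
  have hvT : v ∉ T := fun h => by
    have := hfar v h
    norm_num at this
  have hp : p (T.card + 1) := by
    refine ⟨insert v T, Finset.card_insert_of_notMem hvT, ?_, ?_⟩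
    · intro u hu
      rcases Finset.mem_insert.1 hu with rfl | hu
      exacts [hv, h1 u hu]
    · intro u hu w hw huw
      rcases Finset.mem_insert.1 hu with rfl | hu' <;> rcases Finset.mem_insert.1 hw with rfl | hw'
      · exact absurd rfl huw
      · exact hfar w hw'
      · rw [norm_sub_rev]
        exact hfar u hu'
      · exact h2 u hu' w hw' huw
  have := Nat.le_findGreatest (P := p) (hbound _ hp) hp
  omega

/-- A bound for the quadratic form `‖W v‖² - n ‖v‖²` on a `1/2`-net of the unit sphere extends, up
to a constant, to the whole sphere. -/
theorem abs_norm_sq_sub_le_of_net {m n : ℕ} (W : Matrix (Fin n) (Fin m) ℝ) (r : ℝ)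
    {T : Finset (EuclideanSpace ℝ (Fin m))} (hT1 : ∀ u ∈ T, ‖u‖ = 1)
    (hT : ∀ v : EuclideanSpace ℝ (Fin m), ‖v‖ = 1 → ∃ u ∈ T, ‖v - u‖ < 1 / 2) {s : ℝ}
    (hs : ∀ u ∈ T, |‖mulEuc W u‖ ^ 2 - r| ≤ s) (v : EuclideanSpace ℝ (Fin m)) (hv : ‖v‖ = 1) :
    |‖mulEuc W v‖ ^ 2 - r| ≤ 32 * s := by
  let f := LinearMap.toContinuousLinearMap (Matrix.toEuclideanLin W)
  have hf : ∀ v, mulEuc W v = f v := fun _ => rfl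
  simp only [hf] at hs ⊢
  let h : EuclideanSpace ℝ (Fin m) → ℝ := fun v => ‖f v‖ ^ 2 - r * ‖v‖ ^ 2
  have hh : ∀ v, ‖v‖ = 1 → h v = ‖f v‖ ^ 2 - r := fun v hv => by simp [h, hv]
  have hcont : Continuous fun v => |h v| := by fun_prop
  obtain ⟨w, hw, hmax⟩ := (isCompact_sphere (0 : EuclideanSpace ℝ (Fin m)) 1).exists_isMaxOn
    ⟨v, by simpa using hv⟩ hcont.continuousOn
  have hw1 : ‖w‖ = 1 := by simpa using hw
  have hle : ∀ x, |h x| ≤ |h w| * ‖x‖ ^ 2 := by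
    intro x
    rcases eq_or_ne x 0 with rfl | hx
    · simp [h]
    have hx0 : 0 < ‖x‖ := norm_pos_iff.2 hx
    have h1 : |h (‖x‖⁻¹ • x)| ≤ |h w| := hmax (by simpa using norm_smul_inv_norm (𝕜 := ℝ) hx)
    have h2 : h (‖x‖⁻¹ • x) = h x / ‖x‖ ^ 2 := by
      simp only [h, map_smul, norm_smul, norm_inv, norm_norm]
      field_simp
    rwa [h2, abs_div, abs_of_pos (pow_pos hx0 2), div_le_iff₀ (pow_pos hx0 2)] at h1
  obtain ⟨u, hu, hwu⟩ := hT w hw1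
  have hu1 := hT1 u hu
  -- polarization of the rescaled orthogonal vectors `2 (w - u)` and `(w + u) / 2`
  have key : 4 * (h w - h u) =
      h ((5 / 2 : ℝ) • w - (3 / 2 : ℝ) • u) - h ((3 / 2 : ℝ) • w - (5 / 2 : ℝ) • u) := by
    simp only [h, map_sub, map_smul, @norm_sub_sq_real, norm_smul, real_inner_smul_left,
      real_inner_smul_right, mul_pow]
    norm_num
    ring
  have hn : ‖(5 / 2 : ℝ) • w - (3 / 2 : ℝ) • u‖ ^ 2 + ‖(3 / 2 : ℝ) • w - (5 / 2 : ℝ) • u‖ ^ 2 ≤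
      31 / 8 := by
    have hd : ‖w - u‖ ^ 2 ≤ 1 / 4 := by nlinarith [norm_nonneg (w - u)]
    simp only [@norm_sub_sq_real, norm_smul, real_inner_smul_left, real_inner_smul_right, hw1,
      hu1, mul_pow] at hd ⊢
    norm_num at hd ⊢
    linarith
  have h1 := hle ((5 / 2 : ℝ) • w - (3 / 2 : ℝ) • u)
  have h2 := hle ((3 / 2 : ℝ) • w - (5 / 2 : ℝ) • u)
  have h3 : |h (((5 / 2 : ℝ) • w - (3 / 2 : ℝ) • u)) -
      h ((3 / 2 : ℝ) • w - (5 / 2 : ℝ) • u)| ≤ |h w| * (31 / 8) := by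
    refine (abs_sub _ _).trans ((add_le_add h1 h2).trans ?_)
    rw [← mul_add]
    gcongr
  rw [← key, abs_mul, abs_of_pos (by norm_num : (0 : ℝ) < 4)] at h3
  have h4 : |h u| ≤ s := by
    rw [hh u hu1]
    exact hs u hu
  have h5 : |h w| - |h u| ≤ |h w - h u| := abs_sub_abs_le_abs_sub _ _
  have h6 : |h v| ≤ |h w| := hmax (by simpa using hv)
  rw [← hh v hv]
  linarith

/-- A bound for `a² - n` gives a bound for `a - √n` without loss in `n`. -/
theorem abs_sub_sqrt_le {a n k r : ℝ} (ha : 0 ≤ a) (hn : 0 ≤ n) (hk : 1 ≤ k) (hr : 0 ≤ r)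
    (h : |a ^ 2 - n| ≤ k * (√n * r + r ^ 2)) : |a - √n| ≤ 2 * k * r := by
  have hs0 := Real.sqrt_nonneg n
  have hs : √n ^ 2 = n := Real.sq_sqrt hn
  set x := √n with hx
  by_contra! hlt
  have hfac : |a ^ 2 - n| = |a - x| * (a + x) := by
    rw [← hs, show a ^ 2 - x ^ 2 = (a - x) * (a + x) by ring, abs_mul,
      abs_of_nonneg (by linarith : 0 ≤ a + x)]
  set d := |a - x| with hd
  have hd0 : 0 ≤ d := abs_nonneg _
  have hkr : 0 ≤ k * r := by positivity
  have hrk : r ≤ k * r := le_mul_of_one_le_left hr hk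
  have hdpos : 0 < d := by linarith
  have hdx : d ≤ a + x := abs_le.2 ⟨by linarith, by linarith⟩
  rw [hfac] at h
  -- both `x` and `d` are at most `a + x`
  have e1 : k * r * x ≤ k * r * (a + x) := by gcongr; linarith
  have e2 : k * r * r ≤ k * r * (a + x) := by gcongr; linarith
  have e3 : 2 * k * r * (a + x) < d * (a + x) := by
    apply mul_lt_mul_of_pos_right hlt
    linarith
  nlinarith

end Net

section Rows

variable {Ω : Type*} [MeasurableSpace Ω] {P : Measure Ω} [IsProbabilityMeasure P] {m : ℕ}

theorem IsSubGaussianVector.memLp {σ : ℝ≥0} {V : Ω → EuclideanSpace ℝ (Fin m)}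
    (h : IsSubGaussianVector P σ V) : MemLp V 2 P := by
  refine MemLp.of_eval_piLp fun i => ?_
  have h1 := (h (EuclideanSpace.single i 1) (by simp)).memLp 2
  have h2 := h1.add (memLp_const (∫ ω', inner ℝ (EuclideanSpace.single i (1 : ℝ)) (V ω') ∂P))
  refine h2.ae_eq (ae_of_all _ fun ω => ?_)
  simp [EuclideanSpace.inner_single_left]

theorem IsSubGaussianVector.hasSubgaussianMGF_inner {σ : ℝ≥0} {V : Ω → EuclideanSpace ℝ (Fin m)}
    (h : IsSubGaussianVector P σ V) (h0 : ∫ ω, V ω ∂P = 0) {v : EuclideanSpace ℝ (Fin m)}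
    (hv : ‖v‖ = 1) : HasSubgaussianMGF (fun ω => inner ℝ v (V ω)) (σ ^ 2) P := by
  have h1 := h v hv
  rw [integral_inner (h.memLp.integrable one_le_two), h0, inner_zero_right] at h1
  simpa using h1

theorem integral_inner_sq_of_covMat_eq_one {V : Ω → EuclideanSpace ℝ (Fin m)} (hV : MemLp V 2 P)
    (h0 : ∫ ω, V ω ∂P = 0) (hcov : covMat P V = 1) {v : EuclideanSpace ℝ (Fin m)}
    (hv : ‖v‖ = 1) : ∫ ω, inner ℝ v (V ω) ^ 2 ∂P = 1 := by
  let B : Matrix (Fin 1) (Fin m) ℝ := Matrix.of fun _ j => v j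
  have h := integral_norm_sq_eq_trace_covMat (memLp_mulEuc B hV) (by
    rw [integral_mulEuc B (hV.integrable one_le_two), h0]
    simp [mulEuc])
  rw [covMat_mulEuc B hV, hcov, Matrix.mul_one, ← Matrix.transpose_transpose B,
    Matrix.transpose_transpose Bᵀ, Matrix.trace_mul_comm, trace_transpose_mul] at h
  have e : ∀ ω, ‖mulEuc B (V ω)‖ ^ 2 = inner ℝ v (V ω) ^ 2 := by
    intro ω
    rw [norm_sq_eq_dotProduct, inner_eq_dotProduct, ofLp_mulEuc]
    simp [B, Matrix.mulVec, dotProduct, sq]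
  simp_rw [Matrix.transpose_transpose, e] at h
  rw [h]
  have : ‖v‖ ^ 2 = 1 := by rw [hv, one_pow]
  rw [norm_sq_eq_dotProduct] at this
  simpa [B, dotProduct] using this

theorem norm_mulEuc_rows_sq {n : ℕ} (w : Fin n → EuclideanSpace ℝ (Fin m))
    (v : EuclideanSpace ℝ (Fin m)) :
    ‖mulEuc (Matrix.of fun i j => w i j) v‖ ^ 2 = ∑ i, inner ℝ v (w i) ^ 2 := by
  rw [norm_sq_eq_dotProduct, ofLp_mulEuc]
  refine Finset.sum_congr rfl fun i _ => ?_
  rw [inner_eq_dotProduct, dotProduct_comm, ← sq]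
  rfl

/-- Concentration of `‖W v‖²` on a net of unit vectors `v`, by Bernstein's inequality and a union
bound, extends to the sphere. -/
theorem isSingularValueConst : IsSingularValueConst 4096 := by
  intro n M Ω _ P _ ρ row hrow hind h0 hcov hsub t ht
  set good := {ω | ∀ v : EuclideanSpace ℝ (Fin M), ‖v‖ = 1 →
        √(n : ℝ) - 4096 * (ρ : ℝ) ^ 2 * (√(M : ℝ) + √t)
            ≤ ‖mulEuc (Matrix.of fun i j => row i ω j) v‖ ∧
          ‖mulEuc (Matrix.of fun i j => row i ω j) v‖
            ≤ √(n : ℝ) + 4096 * (ρ : ℝ) ^ 2 * (√(M : ℝ) + √t)}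
  have htriv : (∀ ω, ω ∈ good) → 1 - 2 * Real.exp (-t) ≤ P.real good := fun h => by
    rw [Set.eq_univ_of_forall h, probReal_univ]
    linarith [Real.exp_pos (-t)]
  rcases Nat.eq_zero_or_pos M with rfl | hM
  · -- there are no unit vectors
    apply htriv
    intro ω v hv
    rw [Subsingleton.elim v 0, norm_zero] at hv
    exact absurd hv zero_ne_one
  have hM' : (0 : ℝ) < M := by exact_mod_cast hM
  rcases Nat.eq_zero_or_pos n with rfl | hn
  · -- the matrix has no rows
    apply htriv
    intro ω v _
    have hz : ‖mulEuc (Matrix.of fun (i : Fin 0) j => row i ω j) v‖ = 0 := by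
      rw [Subsingleton.elim (mulEuc _ v) 0, norm_zero]
    have hc : 0 ≤ 4096 * (ρ : ℝ) ^ 2 * (√(M : ℝ) + √t) := by positivity
    rw [hz, Nat.cast_zero, Real.sqrt_zero]
    exact ⟨by linarith, by linarith⟩
  obtain ⟨T, hTcard, hT1, hT⟩ := exists_sphere_net M
  set q : ℝ := t + 2 * M with hq
  have hq0 : 0 < q := by positivity
  have hmem := fun i => (hsub i).memLp
  have hsq : ∀ i, ∀ v : EuclideanSpace ℝ (Fin M), ‖v‖ = 1 →
      ∫ ω, inner ℝ v (row i ω) ^ 2 ∂P = 1 := fun i v hv =>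
    integral_inner_sq_of_covMat_eq_one (hmem i) (h0 i) (hcov i) hv
  have hmgf : ∀ i, ∀ v : EuclideanSpace ℝ (Fin M), ‖v‖ = 1 →
      HasSubgaussianMGF (fun ω => inner ℝ v (row i ω)) (ρ ^ 2) P := fun i v hv =>
    (hsub i).hasSubgaussianMGF_inner (h0 i) hv
  have hmeas : ∀ i, ∀ v : EuclideanSpace ℝ (Fin M), Measurable fun ω => inner ℝ v (row i ω) :=
    fun i v => by have := hrow i; fun_prop
  have hρ : 1 ≤ (ρ : ℝ) ^ 2 := by
    let v : EuclideanSpace ℝ (Fin M) := EuclideanSpace.single ⟨0, hM⟩ 1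
    have hv : ‖v‖ = 1 := by simp [v]
    have := one_le_of_hasSubgaussianMGF (hmeas ⟨0, hn⟩ v) (hmgf ⟨0, hn⟩ v hv) (hsq ⟨0, hn⟩ v hv)
    simpa using this
  set s := 32 * (ρ : ℝ) ^ 2 * (√n * √q + q) with hs
  let bad : EuclideanSpace ℝ (Fin M) → Set Ω := fun u =>
    {ω | s ≤ |∑ i, inner ℝ u (row i ω) ^ 2 - (n : ℝ)|}
  have hbad : ∀ u ∈ T, P (bad u) ≤ 2 * ENNReal.ofReal (Real.exp (-q)) := by
    intro u hu
    have hu1 := hT1 u hu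
    have := measure_abs_sum_sq_sub_ge_le (P := P) (ξ := fun i ω => inner ℝ u (row i ω))
      (fun i => hmeas i u) (hind.comp (fun _ x => inner ℝ u x) fun _ => by fun_prop)
      (σ := ρ ^ 2) (by rw [← NNReal.coe_pos, NNReal.coe_pow]; linarith)
      (fun i => hmgf i u hu1) (fun i => hsq i u hu1) hq0
    simpa [bad, hs] using this
  have hcover : Set.univ ⊆ good ∪ ⋃ u ∈ T, bad u := by
    intro ω _
    by_cases hω : ω ∈ ⋃ u ∈ T, bad u
    · exact Or.inr hω
    left
    simp only [Set.mem_iUnion, not_exists] at hω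
    have hnet : ∀ u ∈ T, |‖mulEuc (Matrix.of fun i j => row i ω j) u‖ ^ 2 - n| ≤ s := by
      intro u hu
      rw [norm_mulEuc_rows_sq]
      exact (not_le.1 (hω u hu)).le
    intro v hv
    have h1 := abs_norm_sq_sub_le_of_net _ _ hT1 hT hnet v hv
    have h2 : 32 * s = 1024 * (ρ : ℝ) ^ 2 * (√n * √q + √q ^ 2) := by
      rw [hs, Real.sq_sqrt hq0.le]
      ring
    rw [h2] at h1
    have h3 := abs_sub_sqrt_le (norm_nonneg _) (Nat.cast_nonneg n) (by linarith)
      (Real.sqrt_nonneg q) h1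
    have h4 : √q ≤ 2 * (√M + √t) := by
      rw [Real.sqrt_le_left (by positivity), hq]
      nlinarith [Real.sq_sqrt ht, Real.sq_sqrt hM'.le, Real.sqrt_nonneg t, Real.sqrt_nonneg M,
        mul_nonneg (Real.sqrt_nonneg (M : ℝ)) (Real.sqrt_nonneg t)]
    have h5 : 2 * (1024 * (ρ : ℝ) ^ 2) * √q ≤ 4096 * (ρ : ℝ) ^ 2 * (√M + √t) := by
      calc _ ≤ 2 * (1024 * (ρ : ℝ) ^ 2) * (2 * (√M + √t)) := by gcongr
        _ = _ := by ring
    have h6 := abs_le.1 (h3.trans h5)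
    exact ⟨by linarith [h6.1], by linarith [h6.2]⟩
  have hsum : P (⋃ u ∈ T, bad u) ≤ ENNReal.ofReal (2 * Real.exp (-t)) := by
    calc P (⋃ u ∈ T, bad u) ≤ ∑ u ∈ T, P (bad u) := measure_biUnion_finset_le _ _
      _ ≤ ∑ _u ∈ T, 2 * ENNReal.ofReal (Real.exp (-q)) := Finset.sum_le_sum hbad
      _ = T.card * (2 * ENNReal.ofReal (Real.exp (-q))) := by rw [Finset.sum_const, nsmul_eq_mul]
      _ = ENNReal.ofReal (T.card * (2 * Real.exp (-q))) := by
          rw [ENNReal.ofReal_mul (Nat.cast_nonneg _), ENNReal.ofReal_mul two_pos.le]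
          simp
      _ ≤ _ := by
          refine ENNReal.ofReal_le_ofReal ?_
          have h5 : (T.card : ℝ) ≤ Real.exp (2 * M) := by
            have e2 : (5 : ℝ) ≤ Real.exp 2 := by
              have := Real.quadratic_le_exp_of_nonneg (two_pos (α := ℝ)).le
              linarith
            calc (T.card : ℝ) ≤ 5 ^ M := by exact_mod_cast hTcard
              _ ≤ Real.exp 2 ^ M := by gcongr
              _ = _ := by rw [← Real.exp_nat_mul, mul_comm]
          calc (T.card : ℝ) * (2 * Real.exp (-q)) ≤ Real.exp (2 * M) * (2 * Real.exp (-q)) := by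
                gcongr
            _ = 2 * (Real.exp (2 * M) * Real.exp (-q)) := by ring
            _ = _ := by rw [← Real.exp_add, hq]; congr 2; ring
  have hU : 1 ≤ P.real good + P.real (⋃ u ∈ T, bad u) := by
    rw [← probReal_univ (μ := P)]
    exact (measureReal_mono hcover).trans (measureReal_union_le _ _)
  have hr : P.real (⋃ u ∈ T, bad u) ≤ 2 * Real.exp (-t) :=
    ENNReal.toReal_le_of_le_ofReal (by positivity) hsum
  linarith

end Rows

/-! ### From the law of the samples to the two events -/

section Transfer

variable {Ω Ω' : Type*} [MeasurableSpace Ω] [MeasurableSpace Ω'] {P : Measure Ω} {P' : Measure Ω'}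
  {m : ℕ} {V : Ω → EuclideanSpace ℝ (Fin m)} {V' : Ω' → EuclideanSpace ℝ (Fin m)}

theorem covMat_map (hV : AEMeasurable V P) : covMat (P.map V) id = covMat P V := by
  ext i j
  exact covariance_map_fun (X := fun u : EuclideanSpace ℝ (Fin m) => u i)
    (Y := fun u : EuclideanSpace ℝ (Fin m) => u j) (by fun_prop) (by fun_prop) hV

theorem ProbabilityTheory.IdentDistrib.covMat_eq (h : IdentDistrib V V' P P') :
    covMat P V = covMat P' V' := by
  rw [← covMat_map h.aemeasurable_fst, ← covMat_map h.aemeasurable_snd, h.map_eq]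

theorem IsSubGaussianVector.congr_identDistrib {σ : ℝ≥0} (hV : IsSubGaussianVector P σ V)
    (h : IdentDistrib V V' P P') : IsSubGaussianVector P' σ V' := by
  intro a ha
  have h1 : IdentDistrib (fun ω => inner ℝ a (V ω)) (fun ω => inner ℝ a (V' ω)) P P' :=
    h.comp (u := fun v => inner ℝ a v) (by fun_prop)
  rw [← h1.integral_eq]
  exact (hV a ha).congr_identDistrib
    (h1.comp (u := fun x => x - ∫ ω', inner ℝ a (V ω') ∂P) (by fun_prop))

theorem measurableSet_singularValue_bounds {n : ℕ} (lo hi : ℝ) :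
    MeasurableSet {z : Fin n → EuclideanSpace ℝ (Fin m) | ∀ v : EuclideanSpace ℝ (Fin m), ‖v‖ = 1 →
      lo ≤ ‖mulEuc (Matrix.of fun i j => z i j) v‖ ∧
        ‖mulEuc (Matrix.of fun i j => z i j) v‖ ≤ hi} := by
  have hc : ∀ v : EuclideanSpace ℝ (Fin m), Continuous
      fun z : Fin n → EuclideanSpace ℝ (Fin m) => ‖mulEuc (Matrix.of fun i j => z i j) v‖ := by
    intro v
    have : ∀ z : Fin n → EuclideanSpace ℝ (Fin m), ‖mulEuc (Matrix.of fun i j => z i j) v‖ =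
        √(∑ i, inner ℝ v (z i) ^ 2) := fun z => by
      rw [← norm_mulEuc_rows_sq, Real.sqrt_sq (norm_nonneg _)]
    simp_rw [this]
    fun_prop
  apply IsClosed.measurableSet
  simp only [Set.ofPred_forall]
  exact isClosed_iInter fun v => isClosed_iInter fun _ =>
    (isClosed_le continuous_const (hc v)).inter (isClosed_le (hc v) continuous_const)

/-- The bound for the singular values holds for rows defined on a probability space in an arbitrary
universe: the joint law of the rows lives on a space in the lowest one. -/
theorem IsSingularValueConst.le_measureReal {c : ℝ} (hc : IsSingularValueConst c) {n : ℕ}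
    [IsProbabilityMeasure P] {ρ : ℝ≥0} {row : Fin n → Ω → EuclideanSpace ℝ (Fin m)}
    (hrow : ∀ i, Measurable (row i)) (hind : iIndepFun row P) (h0 : ∀ i, ∫ ω, row i ω ∂P = 0)
    (hcov : ∀ i, covMat P (row i) = 1) (hsub : ∀ i, IsSubGaussianVector P ρ (row i)) {t : ℝ}
    (ht : 0 ≤ t) :
    1 - 2 * Real.exp (-t) ≤ P.real {ω | ∀ v : EuclideanSpace ℝ (Fin m), ‖v‖ = 1 →
      √(n : ℝ) - c * (ρ : ℝ) ^ 2 * (√(m : ℝ) + √t)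
          ≤ ‖mulEuc (Matrix.of fun i j => row i ω j) v‖ ∧
        ‖mulEuc (Matrix.of fun i j => row i ω j) v‖
          ≤ √(n : ℝ) + c * (ρ : ℝ) ^ 2 * (√(m : ℝ) + √t)} := by
  have hprob : ∀ i, IsProbabilityMeasure (P.map (row i)) := fun i =>
    Measure.isProbabilityMeasure_map (hrow i).aemeasurable
  set Q : Measure (Fin n → EuclideanSpace ℝ (Fin m)) := Measure.pi fun i => P.map (row i) with hQ
  have hlaw : P.map (fun ω i => row i ω) = Q :=
    (iIndepFun_iff_map_fun_eq_pi_map fun i => (hrow i).aemeasurable).1 hind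
  have hid : ∀ i, IdentDistrib (row i) (fun z : Fin n → EuclideanSpace ℝ (Fin m) => z i) P Q :=
    fun i => ⟨(hrow i).aemeasurable, (measurable_pi_apply i).aemeasurable,
      (measurePreserving_eval (fun i => P.map (row i)) i).map_eq.symm⟩
  have h := hc n m (Fin n → EuclideanSpace ℝ (Fin m)) Q ρ (fun i z => z i) measurable_pi_apply
    (iIndepFun_pi (X := fun _ x => x) fun i => aemeasurable_id)
    (fun i => by rw [← (hid i).integral_eq, h0 i])
    (fun i => by rw [← (hid i).covMat_eq, hcov i])
    (fun i => (hsub i).congr_identDistrib (hid i)) t ht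
  rw [← hlaw, map_measureReal_apply (measurable_pi_iff.2 hrow)
    (measurableSet_singularValue_bounds _ _)] at h
  exact h

end Transfer

section Samples

variable {Ω Ω' : Type*} [MeasurableSpace Ω] [MeasurableSpace Ω'] {P : Measure Ω}
  [IsProbabilityMeasure P] {P' : Measure Ω'} [IsProbabilityMeasure P'] {M N n : ℕ}
  {X : Ω → EuclideanSpace ℝ (Fin N)} {Y : Ω → EuclideanSpace ℝ (Fin M)}
  {Xs : Fin n → Ω' → EuclideanSpace ℝ (Fin N)} {Ys : Fin n → Ω' → EuclideanSpace ℝ (Fin M)}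

/-- The whitened samples satisfy the hypotheses of the bound for the singular values. -/
theorem le_measureReal_designMat {c : ℝ} (hc : IsSingularValueConst c) (hY2 : MemLp Y 2 P)
    (hY0 : ∫ ω, Y ω ∂P = 0) (hV : (covMat P Y).PosDef) {ρ : ℝ≥0}
    (hρ : IsSubGaussianVector P ρ fun ω => mulEuc (invSqrt (covMat P Y)) (Y ω))
    (hYs : ∀ i, Measurable (Ys i)) (hind : iIndepFun (fun i ω => (Xs i ω, Ys i ω)) P')
    (hid : ∀ i, IdentDistrib (fun ω => (Xs i ω, Ys i ω)) (fun ω => (X ω, Y ω)) P' P) {t : ℝ}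
    (ht : 0 ≤ t) :
    1 - 2 * Real.exp (-t) ≤ P'.real {ω | ∀ v : EuclideanSpace ℝ (Fin M), ‖v‖ = 1 →
      √(n : ℝ) - c * (ρ : ℝ) ^ 2 * (√(M : ℝ) + √t)
        ≤ ‖mulEuc (designMat (invSqrt (covMat P Y)) fun i => Ys i ω) v‖} := by
  set R := invSqrt (covMat P Y) with hR
  have hRm := measurable_mulEuc R
  have hid' : ∀ i, IdentDistrib (fun ω => mulEuc R (Y ω)) (fun ω => mulEuc R (Ys i ω)) P P' :=
    fun i => ((hid i).comp (hRm.comp measurable_snd)).symm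
  refine (hc.le_measureReal (fun i => hRm.comp (hYs i))
    (hind.comp (fun _ p => mulEuc R p.2) fun _ => hRm.comp measurable_snd) (fun i => ?_)
    (fun i => ?_) (fun i => hρ.congr_identDistrib (hid' i)) ht).trans
    (measureReal_mono fun ω hω v hv => (hω v hv).1)
  · refine (hid' i).symm.integral_eq.trans ?_
    rw [integral_mulEuc R (hY2.integrable one_le_two), hY0]
    simp [mulEuc]
  · refine (hid' i).symm.covMat_eq.trans ?_
    rw [covMat_mulEuc R hY2, transpose_invSqrt, invSqrt_mul_mul_invSqrt hV]

/-- The tail bound for the projected noise of the samples. -/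
theorem measureReal_noise_event_le [NeZero M] [NeZero N] {C : Matrix (Fin N) (Fin N) ℝ}
    (hC : C.PosDef) (hX : Measurable X) (hY : Measurable Y) {L : Matrix (Fin N) (Fin M) ℝ}
    (hE : IsCondSubGaussian P C (fun ω => X ω - mulEuc L (Y ω)) Y)
    (h0 : ∀ᵐ y ∂(P.map Y), ∫ e, e ∂(condDistrib (fun ω => X ω - mulEuc L (Y ω)) Y P y) = 0)
    (hXs : ∀ i, Measurable (Xs i)) (hYs : ∀ i, Measurable (Ys i))
    (hind : iIndepFun (fun i ω => (Xs i ω, Ys i ω)) P')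
    (hid : ∀ i, IdentDistrib (fun ω => (Xs i ω, Ys i ω)) (fun ω => (X ω, Y ω)) P' P)
    (R : Matrix (Fin M) (Fin M) ℝ) {t : ℝ} (ht : 0 < t) :
    P'.real {ω | ((designMat R fun i => Ys i ω)ᵀ * designMat R fun i => Ys i ω).det ≠ 0 ∧
      C.trace * M + 2 * √(M * (C ^ 2).trace * t) + 2 * specNorm C * t ≤
        projNoise (designMat R fun i => Ys i ω)
          (rowMat fun i => Xs i ω - mulEuc L (Ys i ω))} ≤ Real.exp (-t) := by
  have hLm := measurable_mulEuc L
  let u : EuclideanSpace ℝ (Fin N) × EuclideanSpace ℝ (Fin M) →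
    EuclideanSpace ℝ (Fin M) × EuclideanSpace ℝ (Fin N) := fun p => (p.2, p.1 - mulEuc L p.2)
  have hu : Measurable u :=
    measurable_snd.prodMk (measurable_fst.sub (hLm.comp measurable_snd))
  have hum : ∀ i, Measurable fun ω => u (Xs i ω, Ys i ω) := fun i =>
    hu.comp ((hXs i).prodMk (hYs i))
  have hlaw : P'.map (fun ω i => u (Xs i ω, Ys i ω)) =
      Measure.pi fun _ : Fin n => P.map fun ω => (Y ω, X ω - mulEuc L (Y ω)) := by
    rw [(iIndepFun_iff_map_fun_eq_pi_map fun i => (hum i).aemeasurable).1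
      (hind.comp (fun _ => u) fun _ => hu)]
    congr 1
    ext1 i
    exact ((hid i).comp hu).map_eq
  have h := measure_pi_noise_event_le (n := n)
    (E := fun ω => X ω - mulEuc L (Y ω)) hC (hX.sub (hLm.comp hY)) hY hE h0 R ht
  refine ENNReal.toReal_le_of_le_ofReal (Real.exp_pos _).le ?_
  rw [← hlaw, Measure.map_apply (measurable_pi_iff.2 hum) (measurableSet_noise_event R _)] at h
  exact h

theorem isLeastSquaresEstimator_of_subsingleton
    [Subsingleton (EuclideanSpace ℝ (Fin M) →ₗ[ℝ] EuclideanSpace ℝ (Fin N))]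
    (x : Fin n → EuclideanSpace ℝ (Fin N)) (y : Fin n → EuclideanSpace ℝ (Fin M))
    (f : EuclideanSpace ℝ (Fin M) →ₗ[ℝ] EuclideanSpace ℝ (Fin N)) :
    IsLeastSquaresEstimator x y f :=
  ⟨fun g => by rw [Subsingleton.elim g f], fun g _ => Subsingleton.elim g f⟩

end Samples

/-! ### The sample size bound -/

theorem mainTheorem4 :
    (∃ c : ℝ, 0 < c ∧ IsSingularValueConst c) ∧
    ∀ c : ℝ, 0 < c → IsSingularValueConst c →
    ∀ {M N : ℕ} (A : Matrix (Fin M) (Fin N) ℝ)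
      -- the model `Y = A X + Z`
      {Ω : Type*} [MeasurableSpace Ω] (P : Measure Ω) [IsProbabilityMeasure P]
      (X : Ω → EuclideanSpace ℝ (Fin N)) (Z Y : Ω → EuclideanSpace ℝ (Fin M))
      (_hX : Measurable X) (_hZ : Measurable Z) (_hXZ : IndepFun X Z P)
      (_hX2 : MemLp X 2 P) (_hZ2 : MemLp Z 2 P)
      (_hX0 : ∫ ω, X ω ∂P = 0) (_hZ0 : ∫ ω, Z ω ∂P = 0)
      (_hCXX : IsUnit (covMat P X)) (_hCZZ : IsUnit (covMat P Z))
      (_hY : Y = fun ω => mulEuc A (X ω) + Z ω)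
      -- the estimation error of the LMMSE estimator is conditionally sub-Gaussian
      (C : Matrix (Fin N) (Fin N) ℝ) (_hC : C.PosDef)
      (_hE : IsCondSubGaussian P C
        (fun ω => X ω - mulEuc (lmmseMat A (covMat P X) (covMat P Z)) (Y ω)) Y)
      -- the whitened data are sub-Gaussian
      (ρ : ℝ≥0) (_hρ : IsSubGaussianVector P ρ fun ω => mulEuc (invSqrt (covMat P Y)) (Y ω))
      -- the LMMSE and the MMSE estimators coincide
      (_hMMSE : P[X | MeasurableSpace.comap Y inferInstance] =ᵐ[P]
        fun ω => mulEuc (lmmseMat A (covMat P X) (covMat P Z)) (Y ω))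
      (ε δ : ℝ) (_hε : 0 < ε) (_hδ0 : 0 < δ) (_hδ1 : δ < 1)
      -- `n` independent samples of `(X, Y)`
      (n : ℕ) (_hn : sampleBound M C (errCov A (covMat P X) (covMat P Z)) c ρ ε δ ≤ n)
      {Ω' : Type*} [MeasurableSpace Ω'] (P' : Measure Ω') [IsProbabilityMeasure P']
      (Xs : Fin n → Ω' → EuclideanSpace ℝ (Fin N)) (Ys : Fin n → Ω' → EuclideanSpace ℝ (Fin M))
      (_hXs : ∀ i, Measurable (Xs i)) (_hYs : ∀ i, Measurable (Ys i))
      (_hindep : iIndepFun (fun i ω => (Xs i ω, Ys i ω)) P')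
      (_hident : ∀ i, IdentDistrib (fun ω => (Xs i ω, Ys i ω)) (fun ω => (X ω, Y ω)) P' P),
      1 - δ ≤ P'.real {ω | ∃ f : EuclideanSpace ℝ (Fin M) →ₗ[ℝ] EuclideanSpace ℝ (Fin N),
        IsLeastSquaresEstimator (fun i => Xs i ω) (fun i => Ys i ω) f ∧
        mse P X Y f ≤ (1 + ε) * (errCov A (covMat P X) (covMat P Z)).trace} := by
  refine ⟨⟨4096, by norm_num, isSingularValueConst⟩, ?_⟩
  intro c hc0 hc M N A Ω _ P _ X Z Y hX hZ hXZ hX2 hZ2 hX0 hZ0 hCXX hCZZ hY C hC hE ρ hρ hMMSE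
    ε δ hε hδ0 hδ1 n hn Ω' _ P' _ Xs Ys hXs hYs hind hid
  have hX' := posDef_covMat hX2 hCXX
  have hZ' := posDef_covMat hZ2 hCZZ
  have hmse := mse_eq hXZ hX2 hZ2 hX0 hZ0 hX' hZ' hY
  have herr := posDef_errCov A hX' hZ'
  set L := lmmseMat A (covMat P X) (covMat P Z) with hL
  set T := (errCov A (covMat P X) (covMat P Z)).trace with hT
  have hT0 : 0 ≤ T := herr.posSemidef.trace_nonneg
  by_cases hsub : Subsingleton (EuclideanSpace ℝ (Fin M) →ₗ[ℝ] EuclideanSpace ℝ (Fin N))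
  · -- one of the dimensions vanishes, and the LMMSE estimator is the only linear map
    refine (by linarith : 1 - δ ≤ 1).trans
      ((probReal_univ (μ := P')).symm.le.trans (measureReal_mono fun ω _ => ?_))
    refine ⟨Matrix.toEuclideanLin L, isLeastSquaresEstimator_of_subsingleton _ _ _, ?_⟩
    rw [hmse, sub_self, Matrix.zero_mul, Matrix.zero_mul, Matrix.trace_zero]
    nlinarith
  have : NeZero M := ⟨by rintro rfl; exact hsub inferInstance⟩
  have : NeZero N := ⟨by rintro rfl; exact hsub inferInstance⟩
  have hM0 : (0 : ℝ) < M := by exact_mod_cast Nat.pos_of_ne_zero (NeZero.ne M)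
  have hTpos : 0 < T := herr.trace_pos
  have hYm : Measurable Y := hY ▸ ((measurable_mulEuc A).comp hX).add hZ
  have hY2 : MemLp Y 2 P := hY ▸ (memLp_mulEuc A hX2).add hZ2
  have hY0 : ∫ ω, Y ω ∂P = 0 := by
    rw [hY, integral_add ((memLp_mulEuc A hX2).integrable one_le_two) (hZ2.integrable one_le_two),
      integral_mulEuc A (hX2.integrable one_le_two), hX0, hZ0]
    simp [mulEuc]
  have hVeq : covMat P Y = A * covMat P X * Aᵀ + covMat P Z := by
    rw [hY, covMat_add_of_indepFun (memLp_mulEuc A hX2) hZ2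
      (hXZ.comp (measurable_mulEuc A) measurable_id), covMat_mulEuc A hX2]
  have hV : (covMat P Y).PosDef := hVeq ▸ posDef_dataCov A hX' hZ'
  rw [← hVeq] at hmse
  set t := Real.log (3 / δ) with ht
  have ht0 : 0 < t := Real.log_pos (by rw [lt_div_iff₀ hδ0]; linarith)
  have hexp : Real.exp (-t) = δ / 3 := by
    rw [Real.exp_neg, ht, Real.exp_log (by positivity), inv_div]
  set R := invSqrt (covMat P Y) with hR
  have hsing := le_measureReal_designMat hc hY2 hY0 hV hρ hYs hind hid ht0.le
  have hnoise := measureReal_noise_event_le hC hX hYm hE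
    (ae_integral_condDistrib_eq_zero hX hYm (hX2.integrable one_le_two)
      (hY2.integrable one_le_two) hMMSE) hXs hYs hind hid R ht0
  rw [← hR] at hsing
  rw [hexp] at hsing hnoise
  set K := C.trace * M + 2 * √(M * (C ^ 2).trace * t) + 2 * specNorm C * t with hK
  have hK0 : 0 < K := by
    have h1 : 0 < C.trace * M := mul_pos hC.trace_pos hM0
    have h2 : 0 ≤ specNorm C := norm_nonneg _
    positivity
  set b := c * (ρ : ℝ) ^ 2 * (√(M : ℝ) + √t) with hb
  have hb0 : 0 ≤ b := by positivity
  have ha0 : 0 < √(K / (T * ε)) := by positivity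
  -- the sample size makes the smallest singular value large
  have hs : √(K / (T * ε)) ≤ √n - b := by
    have h1 : √(K / (T * ε)) + b ≤ √n := Real.le_sqrt_of_sq_le hn
    linarith
  have hs0 : 0 < √n - b := ha0.trans_le hs
  have hKs : K ≤ T * ε * (√n - b) ^ 2 := by
    have h1 : K / (T * ε) ≤ (√n - b) ^ 2 := by
      rw [← Real.sq_sqrt (by positivity : 0 ≤ K / (T * ε))]
      gcongr
    rwa [div_le_iff₀ (by positivity), mul_comm] at h1
  have hcover := measureReal_mono (μ := P') (s₁ := _) (s₂ := _ ∪ _)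
    (fun ω (hω : ω ∈ {ω | ∀ v : EuclideanSpace ℝ (Fin M), ‖v‖ = 1 →
      √(n : ℝ) - b ≤ ‖mulEuc (designMat R fun i => Ys i ω) v‖}) =>
      show ω ∈ {ω | ∃ f : EuclideanSpace ℝ (Fin M) →ₗ[ℝ] EuclideanSpace ℝ (Fin N),
        IsLeastSquaresEstimator (fun i => Xs i ω) (fun i => Ys i ω) f ∧
          mse P X Y f ≤ (1 + ε) * T} ∪
        {ω | ((designMat R fun i => Ys i ω)ᵀ * designMat R fun i => Ys i ω).det ≠ 0 ∧
          K ≤ projNoise (designMat R fun i => Ys i ω)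
            (rowMat fun i => Xs i ω - mulEuc L (Ys i ω))} from ?_)
  · have := hcover.trans (measureReal_union_le _ _)
    linarith
  · obtain ⟨hdet, F, hF, hle⟩ := exists_leastSquaresEstimator hV L
      (x := fun i => Xs i ω) (y := fun i => Ys i ω)
      (e := fun i => Xs i ω - mulEuc L (Ys i ω)) (fun i => by abel) hs0 hω
    by_cases hbad : K ≤ projNoise (designMat R fun i => Ys i ω)
        (rowMat fun i => Xs i ω - mulEuc L (Ys i ω))
    · exact Or.inr ⟨hdet, hbad⟩
    · refine Or.inl ⟨_, hF, ?_⟩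
      rw [hmse F]
      have h1 := hle.trans ((not_le.1 hbad).le.trans hKs)
      have h2 := le_of_mul_le_mul_right h1 (pow_pos hs0 2)
      linarith
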